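/- Let $V$ be a complex Hilbert space with inner product $\langle\cdot|\cdot\rangle$ (antilinear in the first slot), and let $\Omega=\operatorname{Im}\langle\cdot|\cdot\rangle$. Let $SV=\bigoplus_n S^nV$ be its symmetric algebra with the inner product for which the $S^nV$ are mutually perpendicular and $\langle x_1\cdots x_n|y_1\cdots y_n\rangle=\sum_p\prod_j\langle x_j|y_{p(j)}\rangle$, let $SV'$ be the space of all antilinear functionals $SV\to\mathbb C$, with the commutative product $[\Phi\Psi](\theta)=[\Phi\otimes\Psi](\Delta\theta)$ dual to the coproduct $\Delta$ of $SV$ (the algebra homomorphism with $\Delta v=v\otimes 1+1\otimes v$ for $v\in V$), and embed $SV\subset SV'$ by $\phi\mapsto\langle\cdot|\phi\rangle$. Fock space $S[V]\subset SV'$ consists of the bounded antifunctionals; it is the Hilbert space completion of $SV$. For $v\in V$ the creator $c(v)$ on $SV$ is multiplication by $v$ and the annihilator $a(v)$ is the linear derivation of $SV$ with $a(v)w=\langle v|w\rangle$ for $w\in V$; on $SV'$ put $[c(v)\Phi](\psi)=\Phi(a(v)\psi)$ and $[a(v)\Phi](\psi)=\Phi(c(v)\psi)$. For an antilinear operator $Z$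 of a complex Hilbert space $W$ that is symmetric ($\langle y|Zx\rangle=\langle x|Zy\rangle$), the Gaussian is $e^Z=\sum_n\frac1{n!}\zeta^n\in SW'$ (pointwise convergence on $SW$), where $\zeta\in SW'$ vanishes on $S^nW$ for $n\ne2$ and $\zeta(xy)=\langle y|Zx\rangle$. An antilinear map $U:SV\to SV'$ has kernel $u\in S(V\oplus V)'$ if $[U\phi](\psi)=u(\phi_1\psi_2)$ for all $\phi,\psi\in SV$, the indices $1,2$ denoting the maps induced by the two inclusions $V\to V\oplus V$. Let $g$ be an antisymplectic automorphism of $V$: a real-linear bijection with $\Omega(gx,gy)=-\Omega(x,y)$ for all $x,y\in V$. Put $C_g=\frac12(g-igi)$ and $A_g=\frac12(g+igi)$. A weak metaplectic operator implementing $g$ is a nonzero antilinear map $U:SV\to SV'$ such that for all $v\in V$ $$U\,c(v)=\{a(C_gv)+c(A_gv)\}\,U,\qquad U\,a(v)=\{a(A_gv)+c(C_gv)\}\,U .$$ Then: 1. $A_g$ and $A_{g^{-1}}$ are invertible, and $Z_g=A_g^{-1}C_g$ is symmetric with operator norm strictly less than $1$. 2. The antilinear operator $Z$ of $V\oplus V$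 given by $$Z(v_1)=(Z_gv)_1+(A_{g^{-1}}^{-1}v)_2,\qquad Z(v_2)=(A_g^{-1}v)_1+(Z_{g^{-1}}v)_2\qquad(v\in V)$$ has a Gaussian $e^Z\in S(V\oplus V)'$, and the antilinear map $U_g:SV\to SV'$ with kernel $e^Z$ is a weak metaplectic operator implementing $g$. 3. Every weak metaplectic operator implementing $g$ is a nonzero scalar multiple of $U_g$. 4. Some nonzero scalar multiple of $U_g$ is antiunitary (that is, maps $SV$ into $S[V]$ and extends to an antiunitary operator on $S[V]$) if and only if $C_g$ is a Hilbert–Schmidt operator. 5. $C_g$ is Hilbert–Schmidt if and only if the anticommutator $[g,i]_+=gi+ig$ is Hilbert–Schmidt; thus $g$ is implemented by an antiunitary weak metaplectic operator if and only if $[g,i]_+$ is Hilbert–Schmidt. -/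

import Mathlib

open scoped TensorProduct ComplexConjugate

noncomputable section

namespace Fock

variable {V : Type*} [NormedAddCommGroup V] [InnerProductSpace ℂ V]

/-! ### Symmetric algebra, antidual, creators and annihilators -/

/-- The symmetric algebra `SV`. -/
abbrev Sym (V : Type*) [NormedAddCommGroup V] [InnerProductSpace ℂ V] : Type _ :=
  SymmetricAlgebra ℂ V

/-- The inclusion `V → SV`. -/
abbrev inc (V : Type*) [NormedAddCommGroup V] [InnerProductSpace ℂ V] : V →ₗ[ℂ] Sym V :=
  SymmetricAlgebra.ι ℂ V

/-- The homogeneous summand `SⁿV`, spanned by the products of `n` vectors. -/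
def homog (V : Type*) [NormedAddCommGroup V] [InnerProductSpace ℂ V] (n : ℕ) :
    Submodule ℂ (Sym V) :=
  LinearMap.range (inc V) ^ n

/-- The full antidual `SV'`: all antilinear functionals on `SV`. -/
abbrev Antidual (V : Type*) [NormedAddCommGroup V] [InnerProductSpace ℂ V] : Type _ :=
  Sym V →ₗ⋆[ℂ] ℂ

/-- The algebra homomorphism `SV → SV[ε]` with `w ↦ w + ⟨v|w⟩ ε`. -/
def annihilatorHom (v : V) : Sym V →ₐ[ℂ] DualNumber (Sym V) :=
  SymmetricAlgebra.lift
    ((TrivSqZeroExt.inlAlgHom ℂ (Sym V) (Sym V)).toLinearMap ∘ₗ inc V +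
      ((TrivSqZeroExt.inrHom (Sym V) (Sym V)).restrictScalars ℂ) ∘ₗ
        (Algebra.linearMap ℂ (Sym V)) ∘ₗ (innerₛₗ ℂ v))

theorem annihilatorHom_fst (v : V) (φ : Sym V) : (annihilatorHom v φ).fst = φ := by
  have h : (TrivSqZeroExt.fstHom ℂ (Sym V) (Sym V)).comp (annihilatorHom v) =
      AlgHom.id ℂ (Sym V) := by
    apply SymmetricAlgebra.algHom_ext
    ext w
    simp [annihilatorHom]
  exact congr($h φ)

/-- The annihilator `a(v)` on `SV`: the derivation with `a(v) w = ⟨v|w⟩` for `w ∈ V`. -/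
def annih (v : V) : Derivation ℂ (Sym V) (Sym V) :=
  Derivation.mk'
    (((TrivSqZeroExt.sndHom (Sym V) (Sym V)).restrictScalars ℂ) ∘ₗ
      (annihilatorHom v).toLinearMap)
    (fun φ ψ => by
      simp [annihilatorHom_fst, mul_comm])

@[simp]
theorem annih_inc (v w : V) : annih v (inc V w) = algebraMap ℂ (Sym V) (inner ℂ v w) := by
  simp [annih, annihilatorHom, Algebra.algebraMap_eq_smul_one]

theorem derivation_ext {D E : Derivation ℂ (Sym V) (Sym V)}
    (h : ∀ w, D (inc V w) = E (inc V w)) : D = E := by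
  ext φ
  induction φ using SymmetricAlgebra.induction with
  | algebraMap r => simp
  | ι x => exact h x
  | mul a b ha hb => simp [ha, hb]
  | add a b ha hb => simp [ha, hb]

theorem annih_add (v w : V) : annih (v + w) = annih v + annih w :=
  derivation_ext fun x => by simp

theorem annih_smul (c : ℂ) (v : V) : annih (c • v) = conj c • annih v :=
  derivation_ext fun x => by simp [Algebra.smul_def, mul_comm]

theorem annih_comm (v w : V) (φ : Sym V) : annih v (annih w φ) = annih w (annih v φ) := by
  have h : ⁅annih v, annih w⁆ = (0 : Derivation ℂ (Sym V) (Sym V)) :=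
    derivation_ext fun x => by simp [Derivation.commutator_apply]
  have := congr($h φ)
  simpa [Derivation.commutator_apply, sub_eq_zero] using this

/-- The creator `c(v)` on `SV`: multiplication by `v`. -/
def creat (v : V) : Sym V →ₗ[ℂ] Sym V := LinearMap.mulLeft ℂ (inc V v)

/-- The creator `c(v)` on `SV'`: `[c(v)Φ](ψ) = Φ(a(v)ψ)`. -/
def creat' (v : V) : Antidual V →ₗ[ℂ] Antidual V where
  toFun Φ := Φ.comp (annih v).toLinearMap
  map_add' _ _ := rfl
  map_smul' _ _ := rfl

/-- The annihilator `a(v)` on `SV'`: `[a(v)Φ](ψ) = Φ(c(v)ψ)`. -/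
def annih' (v : V) : Antidual V →ₗ[ℂ] Antidual V where
  toFun Φ := Φ.comp (creat v)
  map_add' _ _ := rfl
  map_smul' _ _ := rfl

@[simp]
theorem creat'_apply (v : V) (Φ : Antidual V) (ψ : Sym V) : creat' v Φ ψ = Φ (annih v ψ) := rfl

/-! ### The commutative product of the antidual, quadratics and Gaussians -/

/-- The antifunctional `Φ ⊗ Ψ` on `SV ⊗ SV`. -/
def tensorAnti (Φ Ψ : Antidual V) : (Sym V ⊗[ℂ] Sym V) →ₗ⋆[ℂ] ℂ :=
  TensorProduct.lift (LinearMap.mk₂'ₛₗ (starRingEnd ℂ) (starRingEnd ℂ)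
    (fun φ ψ => Φ φ * Ψ ψ)
    (fun _ _ _ => by simp [add_mul]) (fun _ _ _ => by simp [mul_assoc])
    (fun _ _ _ => by simp [mul_add]) (fun _ _ _ => by simp [mul_left_comm]))

/-- The product of `SV'`: `[ΦΨ](θ) = [Φ ⊗ Ψ](Δθ)`. -/
def mulAnti (Φ Ψ : Antidual V) : Antidual V :=
  (tensorAnti Φ Ψ).comp (Coalgebra.comul (R := ℂ) (A := Sym V))

/-- The unit of `SV'`: the conjugate of the projection `SV → S⁰V = ℂ`. -/
def oneAnti : Antidual V where
  toFun θ := conj (Coalgebra.counit (R := ℂ) θ)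
  map_add' _ _ := by simp
  map_smul' _ _ := by simp

/-- The powers of an element of `SV'`. -/
def powAnti (Φ : Antidual V) : ℕ → Antidual V
  | 0 => oneAnti
  | n + 1 => mulAnti Φ (powAnti Φ n)

/-- `ζ ∈ SV'` is a quadratic: it is concentrated in second degree. -/
def IsQuadratic (ζ : Antidual V) : Prop :=
  ∀ n, n ≠ 2 → ∀ θ ∈ homog V n, ζ θ = 0

/-- `u = e^Z = ∑ ζⁿ / n!` pointwise on `SV`, where `ζ` is the quadratic that corresponds to the
antilinear operator `Z`, that is `ζ(xy) = ⟨y|Zx⟩`.  (Such a `ζ` is unique, and it exists only if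
`Z` is symmetric.) -/
def IsGaussian (Z : V →ₗ⋆[ℂ] V) (u : Antidual V) : Prop :=
  ∃ ζ : Antidual V, IsQuadratic ζ ∧
    (∀ x y, ζ (inc V x * inc V y) = inner ℂ y (Z x)) ∧
    ∀ θ, HasSum (fun n : ℕ => ((n.factorial : ℂ))⁻¹ * powAnti ζ n θ) (u θ)

/-! ### The canonical inner product of `SV` and Fock space -/

theorem creat'_comm (v w : V) : creat' v * creat' w = creat' w * creat' v := by
  ext Φ ψ
  simp [annih_comm]

/-- The commutative algebra of operators on `SV'` generated by the creators. -/
def creatorAlgebra (V : Type*) [NormedAddCommGroup V] [InnerProductSpace ℂ V] :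
    Subalgebra ℂ (Module.End ℂ (Antidual V)) :=
  Algebra.adjoin ℂ (Set.range creat')

instance creatorAlgebra.instCommRing : CommRing (creatorAlgebra V) :=
  { (creatorAlgebra V).toRing with
    mul_comm := (Algebra.isMulCommutative_adjoin ℂ (by
      rintro _ ⟨v, rfl⟩ _ ⟨w, rfl⟩
      exact creat'_comm v w)).is_comm.comm }

/-- The creators of `SV'`, as a linear map on `V`. -/
def creatorLin : V →ₗ[ℂ] creatorAlgebra V where
  toFun v := ⟨creat' v, Algebra.subset_adjoin ⟨v, rfl⟩⟩
  map_add' v w := by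
    ext Φ ψ
    simp [annih_add]
  map_smul' c v := by
    ext Φ ψ
    simp [annih_smul]

/-- The algebra homomorphism from `SV` to the operators on `SV'` with `v ↦ c(v)`. -/
def creatorHom : Sym V →ₐ[ℂ] creatorAlgebra V := SymmetricAlgebra.lift creatorLin

/-- The canonical embedding `SV → SV'`, `φ ↦ ⟨·|φ⟩`: the product `v₁ ⋯ vₙ` is mapped to
`c(v₁) ⋯ c(vₙ) 1`. -/
def embed : Sym V →ₗ[ℂ] Antidual V where
  toFun φ := (creatorHom φ : Module.End ℂ (Antidual V)) oneAnti
  map_add' _ _ := by simp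
  map_smul' _ _ := by simp

/-- The canonical inner product `⟨ψ|φ⟩` of `SV`. -/
def innerS (ψ φ : Sym V) : ℂ := embed φ ψ

theorem innerS_one (ψ : Sym V) : innerS ψ 1 = conj (Coalgebra.counit (R := ℂ) ψ) := by
  simp [innerS, embed, oneAnti]

theorem innerS_inc_mul (v : V) (ψ φ : Sym V) :
    innerS ψ (inc V v * φ) = innerS (annih v ψ) φ := by
  simp [innerS, embed, creatorHom, creatorLin]

theorem annih_prod {n : ℕ} (v : V) (x : Fin (n + 1) → V) :
    annih v (∏ i, inc V (x i)) =
      ∑ i, inner ℂ v (x i) • ∏ j : Fin n, inc V (x (Equiv.swap 0 i j.succ)) := by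
  have key : ∀ s : Finset (Fin (n + 1)), annih v (∏ i ∈ s, inc V (x i)) =
      ∑ i ∈ s, inner ℂ v (x i) • ∏ j ∈ s.erase i, inc V (x j) := by
    intro s
    induction s using Finset.induction_on with
    | empty => simp
    | insert a s ha ih =>
      rw [Finset.prod_insert ha, Derivation.leibniz, ih, Finset.sum_insert ha,
        Finset.erase_insert ha, annih_inc, add_comm]
      congr 1
      · rw [smul_eq_mul, mul_comm, Algebra.smul_def]
      · rw [Finset.smul_sum]
        refine Finset.sum_congr rfl fun i hi => ?_
        have hne : a ≠ i := fun h => ha (h ▸ hi)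
        rw [Finset.erase_insert_of_ne hne, Finset.prod_insert (by simp [ha]), smul_eq_mul,
          mul_smul_comm]
  rw [key]
  refine Finset.sum_congr rfl fun i _ => ?_
  congr 1
  symm
  refine Finset.prod_bij (fun j _ => Equiv.swap 0 i j.succ) ?_ ?_ ?_ ?_
  · intro j _
    simp only [Finset.mem_erase, Finset.mem_univ, and_true]
    intro h
    have := congrArg (Equiv.swap 0 i) h
    simp at this
  · intro j _ k _ h
    simpa using h
  · intro k hk
    have hk' : Equiv.swap 0 i k ≠ 0 := by
      intro h
      have := congrArg (Equiv.swap 0 i) h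
      simp at this
      simp [this] at hk
    obtain ⟨j, hj⟩ := Fin.exists_succ_eq.2 hk'
    exact ⟨j, Finset.mem_univ _, by simp [hj]⟩
  · intro j _
    rfl

theorem innerS_sum_smul {ι : Type*} (s : Finset ι) (c : ι → ℂ) (f : ι → Sym V) (φ : Sym V) :
    innerS (∑ i ∈ s, c i • f i) φ = ∑ i ∈ s, conj (c i) * innerS (f i) φ := by
  simp [innerS]

/-- The defining formula of the canonical inner product on products of `n` vectors. -/
theorem innerS_prod {n : ℕ} (x y : Fin n → V) :
    innerS (∏ i, inc V (x i)) (∏ i, inc V (y i)) =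
      ∑ p : Equiv.Perm (Fin n), ∏ j, inner ℂ (x j) (y (p j)) := by
  have key : ∀ (n : ℕ) (x y : Fin n → V),
      innerS (∏ i, inc V (x i)) (∏ i, inc V (y i)) =
        ∑ p : Equiv.Perm (Fin n), ∏ j, inner ℂ (x (p j)) (y j) := by
    intro n
    induction n with
    | zero => intro x y; simp [innerS_one]
    | succ n ih =>
      intro x y
      rw [Fin.prod_univ_succ (fun i => inc V (y i)), innerS_inc_mul, annih_prod,
        innerS_sum_smul, ← Equiv.sum_comp Equiv.Perm.decomposeFin.symm, Fintype.sum_prod_type]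
      refine Finset.sum_congr rfl fun i _ => ?_
      rw [ih, Finset.mul_sum]
      refine Finset.sum_congr rfl fun p _ => ?_
      rw [Fin.prod_univ_succ]
      simp
  rw [key, ← Equiv.sum_comp (Equiv.inv _)]
  refine Finset.sum_congr rfl fun p _ => ?_
  rw [← Equiv.prod_comp p]
  simp

/-- Products of different degrees are perpendicular. -/
theorem innerS_prod_of_ne {m n : ℕ} (h : m ≠ n) (x : Fin m → V) (y : Fin n → V) :
    innerS (∏ i, inc V (x i)) (∏ i, inc V (y i)) = 0 := by
  induction n generalizing m with
  | zero =>
    obtain ⟨m, rfl⟩ := Nat.exists_eq_succ_of_ne_zero h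
    simp [innerS_one, Fin.prod_univ_succ]
  | succ n ih =>
    rw [Fin.prod_univ_succ (fun i => inc V (y i)), innerS_inc_mul]
    cases m with
    | zero => simp [innerS]
    | succ m =>
      rw [annih_prod, innerS_sum_smul]
      exact Finset.sum_eq_zero fun i _ => by rw [ih (by omega), mul_zero]

/-- `‖Φ(ψ)‖ ≤ M ‖ψ‖` for all `ψ ∈ SV`. -/
def BoundedBy (Φ : Antidual V) (M : ℝ) : Prop :=
  0 ≤ M ∧ ∀ ψ, ‖Φ ψ‖ ≤ M * √(innerS ψ ψ).re

/-- Bosonic Fock space `S[V]`: the subspace of `SV'` of all bounded antifunctionals. -/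
def fockSpace (V : Type*) [NormedAddCommGroup V] [InnerProductSpace ℂ V] :
    Submodule ℂ (Antidual V) where
  carrier := {Φ | ∃ M, BoundedBy Φ M}
  add_mem' := by
    rintro Φ Ψ ⟨M, hM, h⟩ ⟨N, hN, k⟩
    refine ⟨M + N, add_nonneg hM hN, fun ψ => ?_⟩
    rw [add_mul]
    exact (norm_add_le _ _).trans (add_le_add (h ψ) (k ψ))
  zero_mem' := ⟨0, le_rfl, fun ψ => by simp⟩
  smul_mem' := by
    rintro c Φ ⟨M, hM, h⟩
    refine ⟨‖c‖ * M, by positivity, fun ψ => ?_⟩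
    rw [LinearMap.smul_apply, norm_smul, mul_assoc]
    exact mul_le_mul_of_nonneg_left (h ψ) (norm_nonneg _)

/-- The Hilbert space norm of Fock space: the least bound of the antifunctional. -/
def fockNorm (Φ : fockSpace V) : ℝ := sInf {M | BoundedBy (Φ : Antidual V) M}

/-- The antilinear map `U : SV → SV'` is antiunitary on Fock space: it takes values in `S[V]` and
extends to an antiunitary operator of `S[V]`, that is, to a bijective antilinear isometry. -/
def IsAntiunitary (U : Sym V →ₗ⋆[ℂ] Antidual V) : Prop :=
  ∃ W : fockSpace V →ₗ⋆[ℂ] fockSpace V,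
    Function.Bijective W ∧ (∀ Φ, fockNorm (W Φ) = fockNorm Φ) ∧
    ∀ φ : Sym V, ∃ h : embed φ ∈ fockSpace V, (W ⟨embed φ, h⟩ : Antidual V) = U φ

/-! ### Kernels of antilinear maps `SV → SV'` -/

/-- The Hilbert space direct sum `V ⊕ V`. -/
abbrev Double (V : Type*) [NormedAddCommGroup V] [InnerProductSpace ℂ V] : Type _ :=
  WithLp 2 (V × V)

/-- The first inclusion `v ↦ v₁` of `V` in `V ⊕ V`. -/
def inc₁ : V →ₗ[ℂ] Double V :=
  (WithLp.linearEquiv 2 ℂ (V × V)).symm.toLinearMap ∘ₗ LinearMap.inl ℂ V V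

/-- The second inclusion `v ↦ v₂` of `V` in `V ⊕ V`. -/
def inc₂ : V →ₗ[ℂ] Double V :=
  (WithLp.linearEquiv 2 ℂ (V × V)).symm.toLinearMap ∘ₗ LinearMap.inr ℂ V V

/-- The algebra homomorphism `φ ↦ φ₁` from `SV` to `S(V ⊕ V)`. -/
def sym₁ : Sym V →ₐ[ℂ] Sym (Double V) := SymmetricAlgebra.lift (inc (Double V) ∘ₗ inc₁)

/-- The algebra homomorphism `ψ ↦ ψ₂` from `SV` to `S(V ⊕ V)`. -/
def sym₂ : Sym V →ₐ[ℂ] Sym (Double V) := SymmetricAlgebra.lift (inc (Double V) ∘ₗ inc₂)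

/-- The antilinear map `U : SV → SV'` with kernel `u`: `[Uφ](ψ) = u(φ₁ψ₂)`. -/
def kernelOp (u : Antidual (Double V)) : Sym V →ₗ⋆[ℂ] Antidual V :=
  LinearMap.mk₂'ₛₗ (starRingEnd ℂ) (starRingEnd ℂ) (fun φ ψ => u (sym₁ φ * sym₂ ψ))
    (fun _ _ _ => by simp [add_mul]) (fun _ _ _ => by simp)
    (fun _ _ _ => by simp [mul_add]) (fun _ _ _ => by simp)

/-! ### Antisymplectic automorphisms and their metaplectic operators -/

/-- `Ω(gx, gy) = -Ω(x, y)` for the real symplectic form `Ω = Im ⟨·|·⟩`. -/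
def IsAntisymplectic (g : V ≃ₗ[ℝ] V) : Prop :=
  ∀ x y, (inner ℂ (g x) (g y)).im = -(inner ℂ x y).im

theorem map_smul_complex (g : V ≃ₗ[ℝ] V) (c : ℂ) (v : V) :
    g (c • v) = (c.re : ℂ) • g v + (c.im : ℂ) • g (Complex.I • v) := by
  conv_lhs => rw [← Complex.re_add_im c, add_smul, mul_smul, map_add]
  simp only [Complex.coe_smul, map_smul]

theorem map_I_smul_complex (g : V ≃ₗ[ℝ] V) (c : ℂ) (v : V) :
    g (Complex.I • c • v) = (c.re : ℂ) • g (Complex.I • v) - (c.im : ℂ) • g v := by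
  rw [smul_smul, map_smul_complex g]
  simp [sub_eq_add_neg, add_comm]

/-- The complex-linear part `C_g = (g - i g i) / 2`. -/
def linPart (g : V ≃ₗ[ℝ] V) : V →ₗ[ℂ] V where
  toFun v := (2⁻¹ : ℂ) • (g v - Complex.I • g (Complex.I • v))
  map_add' v w := by simp only [smul_add, map_add]; module
  map_smul' c v := by
    rw [map_I_smul_complex, map_smul_complex g c, RingHom.id_apply]
    rw [show c • (2⁻¹ : ℂ) • (g v - Complex.I • g (Complex.I • v)) =
      ((c.re : ℂ) + c.im * Complex.I) • (2⁻¹ : ℂ) • (g v - Complex.I • g (Complex.I • v)) by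
        rw [Complex.re_add_im]]
    match_scalars
    · ring
    · linear_combination (2⁻¹ * (c.im : ℂ)) * Complex.I_sq

/-- The antilinear part `A_g = (g + i g i) / 2`. -/
def antiPart (g : V ≃ₗ[ℝ] V) : V →ₗ⋆[ℂ] V where
  toFun v := (2⁻¹ : ℂ) • (g v + Complex.I • g (Complex.I • v))
  map_add' v w := by simp only [smul_add, map_add]; module
  map_smul' c v := by
    have hc : conj c = (c.re : ℂ) - c.im * Complex.I := by
      apply Complex.ext <;> simp
    rw [map_I_smul_complex, map_smul_complex, hc]
    match_scalars
    · ring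
    · linear_combination (2⁻¹ * (c.im : ℂ)) * Complex.I_sq

/-- The anticommutator `[g, i]₊ = g i + i g`, a complex-linear operator. -/
def anticomm (g : V ≃ₗ[ℝ] V) : V →ₗ[ℂ] V where
  toFun v := g (Complex.I • v) + Complex.I • g v
  map_add' v w := by simp only [smul_add, map_add]; module
  map_smul' c v := by
    rw [map_I_smul_complex, map_smul_complex g c, RingHom.id_apply]
    rw [show c • (g (Complex.I • v) + Complex.I • g v) =
      ((c.re : ℂ) + c.im * Complex.I) • (g (Complex.I • v) + Complex.I • g v) by
        rw [Complex.re_add_im]]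
    match_scalars
    · ring
    · linear_combination -(c.im : ℂ) * Complex.I_sq

/-- The inverse of an antilinear operator (only meaningful, and only used, for bijections). -/
def antiInv (A : V →ₗ⋆[ℂ] V) : V →ₗ⋆[ℂ] V :=
  open Classical in
  if h : Function.Bijective A then (LinearEquiv.ofBijective A h).symm.toLinearMap else 0

/-- The antilinear operator `Z_g = A_g⁻¹ C_g`. -/
def zPart (g : V ≃ₗ[ℝ] V) : V →ₗ⋆[ℂ] V := (antiInv (antiPart g)).comp (linPart g)

/-- The antilinear operator `Z` of `V ⊕ V` with
`Z(v₁) = (Z_g v)₁ + (A_{g⁻¹}⁻¹ v)₂` and `Z(v₂) = (A_g⁻¹ v)₁ + (Z_{g⁻¹} v)₂`. -/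
def kernelZ (g : V ≃ₗ[ℝ] V) : Double V →ₗ⋆[ℂ] Double V where
  toFun w :=
    (inc₁ (zPart g w.fst) + inc₂ (antiInv (antiPart g.symm) w.fst)) +
    (inc₁ (antiInv (antiPart g) w.snd) + inc₂ (zPart g.symm w.snd))
  map_add' v w := by simp only [WithLp.add_fst, WithLp.add_snd, map_add]; abel
  map_smul' c v := by
    simp only [WithLp.smul_fst, WithLp.smul_snd, map_smulₛₗ, RingHom.id_apply, smul_add]

/-- `U` is a weak metaplectic operator implementing the antisymplectic `g`: a nonzero antilinear
map `SV → SV'` with `U c(v) = {a(C_g v) + c(A_g v)} U` and `U a(v) = {a(A_g v) + c(C_g v)} U`. -/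
def IsWeakMetaplectic (g : V ≃ₗ[ℝ] V) (U : Sym V →ₗ⋆[ℂ] Antidual V) : Prop :=
  U ≠ 0 ∧
  (∀ v φ, U (creat v φ) = annih' (linPart g v) (U φ) + creat' (antiPart g v) (U φ)) ∧
  (∀ v φ, U (annih v φ) = annih' (antiPart g v) (U φ) + creat' (linPart g v) (U φ))

/-- The antilinear operator `Z` is symmetric: `⟨y|Zx⟩ = ⟨x|Zy⟩`. -/
def IsSymmetricAnti (Z : V →ₗ⋆[ℂ] V) : Prop :=
  ∀ x y, inner ℂ y (Z x) = inner ℂ x (Z y)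

/-- `T` is a Hilbert-Schmidt operator: it is bounded, and `∑ ‖T eₖ‖² < ∞` for an orthonormal
Hilbert basis `(eₖ)`. -/
def IsHilbertSchmidt (T : V →ₗ[ℂ] V) : Prop :=
  Continuous T ∧ ∃ (w : Set V) (b : HilbertBasis w ℂ V), Summable fun k => ‖T (b k)‖ ^ 2

end Fock

end

/-!
Evaluation on `SV` turns the Gaussian `e^Z` into the solution, normalized to `1` at the vacuum, of
`annih' v u = creat' (Z v) u`. For the operator `Z` of `V ⊕ V` attached to `g`, these equations say
how the operator with kernel `u` moves creators and annihilators across, and by the algebraic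
relations between the parts of `g` and `g⁻¹` they are the intertwining relations. For uniqueness,
apply the relation for `a(v)` to the vacuum and invert `A_g`: this determines `U 1` by its value at
the vacuum, and the relation for `c(v)` then determines `U`. So the intertwiners form a line.

The image of the vacuum is the Gaussian of `Z_{g⁻¹}`. If it is bounded, testing it on the elements
`∑ eₖ Z eₖ` bounds the Hilbert-Schmidt norm of `Z_{g⁻¹}`, and hence that of `C_g`. Conversely, if
`C_g` is Hilbert-Schmidt, the norms of the homogeneous parts of this Gaussian decay geometrically,
because `‖Z_{g⁻¹}‖ < 1`, so that the Gaussian stays bounded after a dilation by some factor `t > 1`.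
All vectors in the image of `U_g` inherit this property, on which creators and annihilators are
mutually adjoint; therefore `U_g` multiplies norms by a constant. Its adjoint is `U_{g⁻¹}`, which
does the same, and so `U_g` is onto.
-/

open scoped TensorProduct ComplexConjugate

noncomputable section

namespace Fock

/-! ### The grading of the symmetric algebra -/

section SymmetricAlgebra

open SymmetricAlgebra Polynomial

variable {R M N P : Type*} [CommSemiring R] [AddCommMonoid M] [Module R M]
  [AddCommMonoid N] [Module R N] [AddCommMonoid P] [Module R P]

@[elab_as_elim]
theorem ι_mul_induction {motive : SymmetricAlgebra R M → Prop} (one : motive 1)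
    (smul : ∀ (c : R) θ, motive θ → motive (c • θ))
    (add : ∀ θ η, motive θ → motive η → motive (θ + η))
    (ι_mul : ∀ v θ, motive θ → motive (ι R M v * θ)) (θ : SymmetricAlgebra R M) : motive θ := by
  suffices h : ∀ η, motive η → motive (θ * η) by simpa using h 1 one
  induction θ using SymmetricAlgebra.induction with
  | algebraMap r => exact fun η hη => Algebra.smul_def r η ▸ smul r η hη
  | ι v => exact ι_mul v
  | mul a b ha hb => exact fun η hη => mul_assoc a b η ▸ ha _ (hb _ hη)
  | add a b ha hb => exact fun η hη => add_mul a b η ▸ add _ _ (ha _ hη) (hb _ hη)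

/-- The algebra homomorphism `SM → SM[X]` with `v ↦ vX`; the coefficients of the image of `θ` are
the homogeneous components of `θ`. -/
def degreeHom (R M : Type*) [CommSemiring R] [AddCommMonoid M] [Module R M] :
    SymmetricAlgebra R M →ₐ[R] (SymmetricAlgebra R M)[X] :=
  lift (((LinearMap.mulRight (SymmetricAlgebra R M) (X : (SymmetricAlgebra R M)[X])).restrictScalars
    R) ∘ₗ (CAlgHom (R := R) (A := SymmetricAlgebra R M)).toLinearMap ∘ₗ ι R M)

@[simp]
theorem degreeHom_ι (v : M) : degreeHom R M (ι R M v) = C (ι R M v) * X := by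
  simp [degreeHom]

theorem degreeHom_of_mem_pow {n : ℕ} {θ : SymmetricAlgebra R M}
    (hθ : θ ∈ LinearMap.range (ι R M) ^ n) : degreeHom R M θ = C θ * X ^ n := by
  induction hθ using Submodule.pow_induction_on_left' with
  | algebraMap r =>
    rw [AlgHom.commutes, pow_zero, mul_one, Polynomial.algebraMap_apply]
  | add θ η n _ _ hθ hη => rw [map_add, hθ, hη, map_add, add_mul]
  | mem_mul v hv n θ _ ih =>
    obtain ⟨v, rfl⟩ := hv
    rw [map_mul, ih, degreeHom_ι, map_mul, Nat.succ_eq_add_one]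
    ring

/-- The projection of the symmetric algebra on its homogeneous summand of degree `n`. -/
def homogProj (n : ℕ) : SymmetricAlgebra R M →ₗ[R] SymmetricAlgebra R M :=
  ((lcoeff (SymmetricAlgebra R M) n).restrictScalars R) ∘ₗ (degreeHom R M).toLinearMap

theorem homogProj_apply (n : ℕ) (θ : SymmetricAlgebra R M) :
    homogProj n θ = (degreeHom R M θ).coeff n := rfl

theorem homogProj_of_mem {n : ℕ} {θ : SymmetricAlgebra R M}
    (hθ : θ ∈ LinearMap.range (ι R M) ^ n) : homogProj n θ = θ := by
  simp [homogProj_apply, degreeHom_of_mem_pow hθ]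

theorem homogProj_of_mem_of_ne {m n : ℕ} (hmn : m ≠ n) {θ : SymmetricAlgebra R M}
    (hθ : θ ∈ LinearMap.range (ι R M) ^ n) : homogProj m θ = 0 := by
  rw [homogProj_apply, degreeHom_of_mem_pow hθ, coeff_C_mul_X_pow, if_neg hmn]

theorem homogProj_zero_ι_mul (v : M) (θ : SymmetricAlgebra R M) :
    homogProj 0 (ι R M v * θ) = 0 := by
  simp [homogProj_apply, mul_assoc]

theorem homogProj_succ_ι_mul (n : ℕ) (v : M) (θ : SymmetricAlgebra R M) :
    homogProj (n + 1) (ι R M v * θ) = ι R M v * homogProj n θ := by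
  simp [homogProj_apply, mul_assoc, coeff_X_mul]

theorem homogProj_zero_one : homogProj 0 (1 : SymmetricAlgebra R M) = 1 := by
  simp [homogProj_apply]

theorem homogProj_succ_one (n : ℕ) : homogProj (n + 1) (1 : SymmetricAlgebra R M) = 0 := by
  simp [homogProj_apply, coeff_one]

theorem homogProj_zero (θ : SymmetricAlgebra R M) :
    homogProj 0 θ = algebraMap R _ (Coalgebra.counit (R := R) θ) := by
  induction θ using ι_mul_induction with
  | one => simp [homogProj_zero_one]
  | smul c θ h => rw [map_smul, map_smul, h, smul_eq_mul, map_mul, Algebra.smul_def]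
  | add θ η h k => simp only [map_add, h, k]
  | ι_mul v θ => simp [homogProj_zero_ι_mul, counit_ι]

theorem homogProj_mem (n : ℕ) (θ : SymmetricAlgebra R M) :
    homogProj n θ ∈ LinearMap.range (ι R M) ^ n := by
  induction θ using ι_mul_induction generalizing n with
  | one =>
    cases n with
    | zero => simp [homogProj_zero_one]
    | succ n => simp [homogProj_succ_one]
  | smul c θ h => exact map_smul (homogProj n) c θ ▸ Submodule.smul_mem _ _ (h n)
  | add θ η h k => exact map_add (homogProj n) θ η ▸ Submodule.add_mem _ (h n) (k n)
  | ι_mul v θ h =>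
    cases n with
    | zero => simp [homogProj_zero_ι_mul]
    | succ n =>
      rw [homogProj_succ_ι_mul, pow_succ']
      exact Submodule.mul_mem_mul ⟨v, rfl⟩ (h n)

theorem exists_sum_homogProj_eq (θ : SymmetricAlgebra R M) :
    ∃ N, ∑ n ∈ Finset.range N, homogProj n θ = θ := by
  have eval_one : ((aeval (R := SymmetricAlgebra R M) (1 : SymmetricAlgebra R M)).restrictScalars
      R).comp (degreeHom R M) = AlgHom.id R _ := by
    apply SymmetricAlgebra.algHom_ext
    ext v
    simp
  refine ⟨(degreeHom R M θ).natDegree + 1, ?_⟩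
  calc
    _ = aeval (R := SymmetricAlgebra R M) 1 (degreeHom R M θ) := by
      simp [aeval_eq_sum_range, homogProj_apply]
    _ = θ := congr($eval_one θ)

/-- The homomorphism `SM → SN` of symmetric algebras induced by a linear map `M → N`. -/
def symMap (f : M →ₗ[R] N) : SymmetricAlgebra R M →ₐ[R] SymmetricAlgebra R N := lift (ι R N ∘ₗ f)

@[simp]
theorem symMap_ι (f : M →ₗ[R] N) (v : M) : symMap f (ι R M v) = ι R N (f v) := by
  simp [symMap]

theorem symMap_comp (f : N →ₗ[R] P) (h : M →ₗ[R] N) :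
    (symMap f).comp (symMap h) = symMap (f ∘ₗ h) := by
  apply SymmetricAlgebra.algHom_ext
  ext v
  simp

theorem symMap_id : symMap (LinearMap.id : M →ₗ[R] M) = AlgHom.id R _ := by
  apply SymmetricAlgebra.algHom_ext
  ext v
  simp

theorem counit_symMap (f : M →ₗ[R] N) (θ : SymmetricAlgebra R M) :
    Coalgebra.counit (R := R) (symMap f θ) = Coalgebra.counit (R := R) θ := by
  have h : (Bialgebra.counitAlgHom R _).comp (symMap f) = Bialgebra.counitAlgHom R _ := by
    apply SymmetricAlgebra.algHom_ext
    ext v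
    simp [algebraMapInv_ι]
  exact congr($h θ)

theorem mem_range_symMap_subtype_mono {F G : Submodule R M} (hFG : F ≤ G)
    {θ : SymmetricAlgebra R M} (hθ : θ ∈ (symMap F.subtype).range) :
    θ ∈ (symMap G.subtype).range := by
  obtain ⟨η, rfl⟩ := hθ
  refine ⟨symMap (Submodule.inclusion hFG) η, ?_⟩
  change (symMap G.subtype).comp (symMap (Submodule.inclusion hFG)) η = symMap F.subtype η
  rw [symMap_comp, Submodule.subtype_comp_inclusion]

theorem exists_fg_mem_range_symMap_subtype (θ : SymmetricAlgebra R M) :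
    ∃ F : Submodule R M, F.FG ∧ θ ∈ (symMap F.subtype).range := by
  induction θ using SymmetricAlgebra.induction with
  | algebraMap r => exact ⟨⊥, Submodule.fg_bot, Subalgebra.algebraMap_mem _ r⟩
  | ι v =>
    exact ⟨R ∙ v, Submodule.fg_span_singleton v,
      ι R _ ⟨v, Submodule.mem_span_singleton_self v⟩, by simp⟩
  | mul a b ha hb =>
    obtain ⟨F, hF, ha⟩ := ha
    obtain ⟨G, hG, hb⟩ := hb
    exact ⟨F ⊔ G, hF.sup hG, mul_mem (mem_range_symMap_subtype_mono le_sup_left ha)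
      (mem_range_symMap_subtype_mono le_sup_right hb)⟩
  | add a b ha hb =>
    obtain ⟨F, hF, ha⟩ := ha
    obtain ⟨G, hG, hb⟩ := hb
    exact ⟨F ⊔ G, hF.sup hG, add_mem (mem_range_symMap_subtype_mono le_sup_left ha)
      (mem_range_symMap_subtype_mono le_sup_right hb)⟩

end SymmetricAlgebra

section LiftOfCommute

variable {R M A : Type*} [CommSemiring R] [AddCommMonoid M] [Module R M] [Semiring A]
  [Algebra R A]

open scoped IsMulCommutative in
/-- The extension to the symmetric algebra of a linear map with commuting values in a possibly
noncommutative algebra; it exists because these values generate a commutative subalgebra. -/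
def symLiftOfCommute (f : M →ₗ[R] A) (hf : ∀ v w, Commute (f v) (f w)) :
    SymmetricAlgebra R M →ₐ[R] A :=
  have : IsMulCommutative (Algebra.adjoin R (Set.range f)) :=
    Algebra.isMulCommutative_adjoin R (by rintro _ ⟨v, rfl⟩ _ ⟨w, rfl⟩; exact hf v w)
  (Algebra.adjoin R (Set.range f)).val.comp (SymmetricAlgebra.lift
    (f.codRestrict (Subalgebra.toSubmodule (Algebra.adjoin R (Set.range f)))
      fun v => Algebra.subset_adjoin ⟨v, rfl⟩))

theorem symLiftOfCommute_ι (f : M →ₗ[R] A) (hf : ∀ v w, Commute (f v) (f w)) (v : M) :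
    symLiftOfCommute f hf (SymmetricAlgebra.ι R M v) = f v := by
  simp only [symLiftOfCommute, AlgHom.comp_apply, SymmetricAlgebra.lift_ι_apply]
  rfl

end LiftOfCommute

variable {V W : Type*} [NormedAddCommGroup V] [InnerProductSpace ℂ V]
  [NormedAddCommGroup W] [InnerProductSpace ℂ W]

/-! ### Annihilators on homogeneous elements -/

theorem one_mem_homog : (1 : Sym V) ∈ homog V 0 := by
  simp [homog]

theorem inc_mul_mem_homog {n : ℕ} (v : V) {ψ : Sym V} (hψ : ψ ∈ homog V n) :
    inc V v * ψ ∈ homog V (n + 1) := by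
  rw [homog, pow_succ']
  exact Submodule.mul_mem_mul ⟨v, rfl⟩ hψ

theorem annih_inc_mul (v w : V) (ψ : Sym V) :
    annih v (inc V w * ψ) = inner ℂ v w • ψ + inc V w * annih v ψ := by
  rw [Derivation.leibniz, annih_inc, smul_eq_mul, smul_eq_mul, Algebra.smul_def]
  ring

theorem annih_of_mem_homog_zero (v : V) {ψ : Sym V} (hψ : ψ ∈ homog V 0) : annih v ψ = 0 := by
  rw [homog, pow_zero] at hψ
  obtain ⟨c, rfl⟩ := Submodule.mem_one.1 hψ
  exact (annih v).map_algebraMap c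

theorem homogProj_annih (n : ℕ) (v : V) (ψ : Sym V) :
    homogProj n (annih v ψ) = annih v (homogProj (n + 1) ψ) := by
  induction ψ using ι_mul_induction generalizing n with
  | one => simp [homogProj_succ_one]
  | smul c θ h => simp only [map_smul, Derivation.map_smul, h]
  | add θ η h k => simp only [map_add, h, k]
  | ι_mul w θ h =>
    rw [annih_inc_mul, homogProj_succ_ι_mul, annih_inc_mul, map_add, map_smul]
    cases n with
    | zero => rw [homogProj_zero_ι_mul, annih_of_mem_homog_zero v (homogProj_mem 0 θ), mul_zero]
    | succ n => rw [homogProj_succ_ι_mul, h]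

theorem annih_mem_homog (n : ℕ) (v : V) {ψ : Sym V} (hψ : ψ ∈ homog V (n + 1)) :
    annih v ψ ∈ homog V n := by
  rw [← homogProj_of_mem hψ, ← homogProj_annih]
  exact homogProj_mem n _

/-- To prove a statement about `vψ` one may assume it for `a(Tv)ψ`, which has lower degree. -/
@[elab_as_elim]
theorem annih_induction {motive : Sym V → Prop} (T : V → V) (one : motive 1)
    (smul : ∀ (c : ℂ) θ, motive θ → motive (c • θ))
    (add : ∀ θ η, motive θ → motive η → motive (θ + η))
    (inc_mul : ∀ v ψ, motive (annih (T v) ψ) → motive (inc V v * ψ)) (θ : Sym V) : motive θ := by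
  have zero : motive 0 := by simpa using smul 0 1 one
  have homogeneous : ∀ n, ∀ θ ∈ homog V n, motive θ := by
    intro n
    induction n using Nat.strong_induction_on with | _ n ih
    intro θ hθ
    cases n with
    | zero =>
      rw [homog, pow_zero] at hθ
      obtain ⟨c, rfl⟩ := Submodule.mem_one.1 hθ
      exact Algebra.algebraMap_eq_smul_one (A := Sym V) c ▸ smul c 1 one
    | succ n =>
      rw [homog, pow_succ'] at hθ
      refine Submodule.mul_induction_on hθ ?_ add
      rintro _ ⟨v, rfl⟩ ψ hψ
      refine inc_mul v ψ ?_
      cases n with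
      | zero => exact annih_of_mem_homog_zero (T v) hψ ▸ zero
      | succ n => exact ih n (by omega) _ (annih_mem_homog n (T v) hψ)
  obtain ⟨N, hN⟩ := exists_sum_homogProj_eq θ
  rw [← hN]
  exact Finset.sum_induction _ motive add zero fun n _ => homogeneous n _ (homogProj_mem n θ)

theorem annih_symMap (j : W →ₗ[ℂ] V) {p : V → W} (h : ∀ v w, inner ℂ v (j w) = inner ℂ (p v) w)
    (v : V) (ψ : Sym W) : annih v (symMap j ψ) = symMap j (annih (p v) ψ) := by
  induction ψ using ι_mul_induction with
  | one => simp
  | smul c θ h => simp only [map_smul, Derivation.map_smul, h]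
  | add θ η h k => simp only [map_add, h, k]
  | ι_mul w θ ih => simp only [map_mul, symMap_ι, annih_inc_mul, map_add, map_smul, ih, h]

theorem innerS_symMap (j : W →ₗ[ℂ] V) (p : V →ₗ[ℂ] W)
    (h : ∀ v w, inner ℂ v (j w) = inner ℂ (p v) w) (ψ : Sym W) (φ : Sym V) :
    innerS (symMap j ψ) φ = innerS ψ (symMap p φ) := by
  induction φ using ι_mul_induction generalizing ψ with
  | one => simp [innerS_one, counit_symMap]
  | smul c θ h => simp only [innerS, map_smul, LinearMap.smul_apply] at h ⊢; rw [h]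
  | add θ η h k => simp only [innerS, map_add, LinearMap.add_apply] at h k ⊢; rw [h, k]
  | ι_mul w θ ih =>
    rw [innerS_inc_mul, annih_symMap j h, ih, map_mul, symMap_ι, innerS_inc_mul]

/-! ### The product of the antidual -/

theorem annih'_apply (v : V) (Φ : Antidual V) (ψ : Sym V) : annih' v Φ ψ = Φ (inc V v * ψ) := rfl

theorem oneAnti_apply (ψ : Sym V) :
    (oneAnti : Antidual V) ψ = conj (Coalgebra.counit (R := ℂ) ψ) := rfl

theorem mulAnti_apply (Φ Ψ : Antidual V) (θ : Sym V) :
    mulAnti Φ Ψ θ = tensorAnti Φ Ψ (Coalgebra.comul (R := ℂ) θ) := rfl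

theorem counit_inc_mul (v : V) (ψ : Sym V) : Coalgebra.counit (R := ℂ) (inc V v * ψ) = 0 := by
  rw [Bialgebra.counit_mul, SymmetricAlgebra.counit_ι, zero_mul]

theorem annih'_oneAnti (v : V) : annih' v (oneAnti : Antidual V) = 0 := by
  ext ψ
  rw [annih'_apply, oneAnti_apply, counit_inc_mul, map_zero, LinearMap.zero_apply]

theorem tensorAnti_tmul (Φ Ψ : Antidual V) (φ ψ : Sym V) :
    tensorAnti Φ Ψ (φ ⊗ₜ ψ) = Φ φ * Ψ ψ := by
  simp [tensorAnti]

theorem tensorAnti_comp_map (Φ Ψ : Antidual V) (S T : Sym V →ₗ[ℂ] Sym V) :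
    (tensorAnti Φ Ψ).comp (TensorProduct.map S T) = tensorAnti (Φ.comp S) (Ψ.comp T) :=
  TensorProduct.ext' fun φ ψ => by simp [tensorAnti_tmul]

theorem mulAnti_smul_right (c : ℂ) (Φ Ψ : Antidual V) : mulAnti Φ (c • Ψ) = c • mulAnti Φ Ψ := by
  have h : tensorAnti Φ (c • Ψ) = c • tensorAnti Φ Ψ :=
    TensorProduct.ext' fun φ ψ => by simp [tensorAnti_tmul, mul_left_comm]
  ext θ
  rw [mulAnti_apply, h]
  rfl

theorem oneAnti_mulAnti (Φ : Antidual V) : mulAnti oneAnti Φ = Φ := by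
  have h : tensorAnti oneAnti Φ = (Φ.comp (TensorProduct.lid ℂ (Sym V)).toLinearMap).comp
      ((Coalgebra.counit (R := ℂ)).rTensor (Sym V)) :=
    TensorProduct.ext' fun φ ψ => by simp [tensorAnti_tmul, oneAnti_apply]
  ext θ
  rw [mulAnti_apply, h]
  simp [Coalgebra.rTensor_counit_comul]

theorem comul_creat (v : V) (θ : Sym V) :
    Coalgebra.comul (R := ℂ) (creat v θ) =
      TensorProduct.map (creat v) LinearMap.id (Coalgebra.comul (R := ℂ) θ) +
        TensorProduct.map LinearMap.id (creat v) (Coalgebra.comul (R := ℂ) θ) := by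
  have h : LinearMap.mulLeft ℂ (inc V v ⊗ₜ[ℂ] (1 : Sym V) + (1 : Sym V) ⊗ₜ[ℂ] inc V v) =
      TensorProduct.map (creat v) LinearMap.id + TensorProduct.map LinearMap.id (creat v) :=
    TensorProduct.ext' fun φ ψ => by simp [creat, add_mul]
  rw [← LinearMap.add_apply, ← h, LinearMap.mulLeft_apply, ← SymmetricAlgebra.comul_ι,
    ← Bialgebra.comul_mul]
  rfl

theorem annih'_mulAnti (v : V) (Φ Ψ : Antidual V) :
    annih' v (mulAnti Φ Ψ) = mulAnti (annih' v Φ) Ψ + mulAnti Φ (annih' v Ψ) := by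
  ext θ
  change mulAnti Φ Ψ (creat v θ) = _
  rw [mulAnti_apply, comul_creat, map_add, LinearMap.add_apply, mulAnti_apply, mulAnti_apply]
  have left := congr($(tensorAnti_comp_map Φ Ψ (creat v) LinearMap.id)
    (Coalgebra.comul (R := ℂ) θ))
  have right := congr($(tensorAnti_comp_map Φ Ψ LinearMap.id (creat v))
    (Coalgebra.comul (R := ℂ) θ))
  rw [LinearMap.comp_apply] at left right
  rw [left, right]
  rfl

theorem comul_annih (w : V) (θ : Sym V) :
    Coalgebra.comul (R := ℂ) (annih w θ) =
      TensorProduct.map (annih w).toLinearMap LinearMap.id (Coalgebra.comul (R := ℂ) θ) := by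
  induction θ using ι_mul_induction with
  | one => simp [Algebra.TensorProduct.one_def]
  | smul c θ h => rw [Derivation.map_smul, map_smul, map_smul, map_smul, h]
  | add θ η h k => simp only [map_add, h, k]
  | ι_mul v θ ih =>
    have commutation : TensorProduct.map (annih w).toLinearMap LinearMap.id ∘ₗ
          LinearMap.mulLeft ℂ (inc V v ⊗ₜ[ℂ] (1 : Sym V) + (1 : Sym V) ⊗ₜ[ℂ] inc V v) =
        inner ℂ w v • LinearMap.id +
          LinearMap.mulLeft ℂ (inc V v ⊗ₜ[ℂ] (1 : Sym V) + (1 : Sym V) ⊗ₜ[ℂ] inc V v) ∘ₗ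
            TensorProduct.map (annih w).toLinearMap LinearMap.id :=
      TensorProduct.ext' fun φ ψ => by
        simp only [LinearMap.comp_apply, LinearMap.add_apply, LinearMap.smul_apply,
          LinearMap.mulLeft_apply, LinearMap.id_apply, add_mul, map_add,
          Algebra.TensorProduct.tmul_mul_tmul, one_mul, TensorProduct.map_tmul,
          Derivation.coeFn_coe, annih_inc_mul, TensorProduct.add_tmul, TensorProduct.smul_tmul']
        abel
    rw [annih_inc_mul, map_add, map_smul, Bialgebra.comul_mul, Bialgebra.comul_mul,
      SymmetricAlgebra.comul_ι, ih]
    exact congr($commutation (Coalgebra.comul (R := ℂ) θ)).symm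

theorem mulAnti_comm (Φ Ψ : Antidual V) : mulAnti Φ Ψ = mulAnti Ψ Φ := by
  have h : tensorAnti Φ Ψ =
      (tensorAnti Ψ Φ).comp (TensorProduct.comm ℂ (Sym V) (Sym V)).toLinearMap :=
    TensorProduct.ext' fun φ ψ => by simp [tensorAnti_tmul, mul_comm]
  ext θ
  rw [mulAnti_apply, h]
  simp [mulAnti_apply, Coalgebra.comm_comul]

theorem creat'_mulAnti_left (w : V) (Φ Ψ : Antidual V) :
    mulAnti (creat' w Φ) Ψ = creat' w (mulAnti Φ Ψ) := by
  ext θ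
  rw [creat'_apply, mulAnti_apply, mulAnti_apply, comul_annih]
  exact congr($(tensorAnti_comp_map Φ Ψ (annih w).toLinearMap LinearMap.id) _).symm

theorem creat'_mulAnti_right (w : V) (Φ Ψ : Antidual V) :
    mulAnti Φ (creat' w Ψ) = creat' w (mulAnti Φ Ψ) := by
  rw [mulAnti_comm, creat'_mulAnti_left, mulAnti_comm]

/-! ### Gaussians -/

/-- The differential equation `a(v) u = c(Zv) u` (all `v`) that characterizes the Gaussian `e^Z`
up to a scalar factor. -/
def GaussianEquation (Z : V →ₗ⋆[ℂ] V) (u : Antidual V) : Prop :=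
  ∀ v, annih' v u = creat' (Z v) u

theorem GaussianEquation.apply {Z : V →ₗ⋆[ℂ] V} {u : Antidual V} (hu : GaussianEquation Z u)
    (v : V) (ψ : Sym V) : u (inc V v * ψ) = u (annih (Z v) ψ) :=
  congr($(hu v) ψ)

theorem GaussianEquation.apply_homogProj_two {Z : V →ₗ⋆[ℂ] V} {u : Antidual V}
    (hu : GaussianEquation Z u) (h1 : u 1 = 1) (v : V) :
    annih' v (u.comp (homogProj 2)) = creat' (Z v) oneAnti := by
  ext ψ
  change u (homogProj 2 (inc V v * ψ)) = conj (Coalgebra.counit (R := ℂ) (annih (Z v) ψ))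
  rw [homogProj_succ_ι_mul, hu.apply, ← homogProj_annih, homogProj_zero,
    Algebra.algebraMap_eq_smul_one, map_smulₛₗ, h1, smul_eq_mul, mul_one]

theorem annih'_powAnti_succ {ζ : Antidual V} {v w : V} (hζ : annih' v ζ = creat' w oneAnti)
    (n : ℕ) : annih' v (powAnti ζ (n + 1)) = ((n : ℂ) + 1) • creat' w (powAnti ζ n) := by
  have leibniz (m : ℕ) : annih' v (powAnti ζ (m + 1)) =
      creat' w (powAnti ζ m) + mulAnti ζ (annih' v (powAnti ζ m)) := by
    rw [powAnti, annih'_mulAnti, hζ, creat'_mulAnti_left, oneAnti_mulAnti]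
  induction n with
  | zero =>
    have mul_zero : mulAnti ζ (0 : Antidual V) = 0 := by simpa using mulAnti_smul_right 0 ζ 0
    rw [leibniz, powAnti, annih'_oneAnti, mul_zero]
    simp
  | succ n ih =>
    rw [leibniz, ih, mulAnti_smul_right, creat'_mulAnti_right,
      show mulAnti ζ (powAnti ζ n) = powAnti ζ (n + 1) from rfl]
    push_cast
    module

theorem powAnti_apply_one (ζ : Antidual V) (n : ℕ) : powAnti ζ n 1 = ζ 1 ^ n := by
  induction n with
  | zero => simp [powAnti, oneAnti_apply]
  | succ n ih =>
    rw [powAnti, mulAnti_apply, Bialgebra.comul_one, Algebra.TensorProduct.one_def,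
      tensorAnti_tmul, ih, pow_succ']

theorem GaussianEquation.hasSum_powAnti {Z : V →ₗ⋆[ℂ] V} {u ζ : Antidual V}
    (hu : GaussianEquation Z u) (h1 : u 1 = 1) (hζ1 : ζ 1 = 0)
    (hζ : ∀ v, annih' v ζ = creat' (Z v) oneAnti) (θ : Sym V) :
    HasSum (fun n : ℕ => (n.factorial : ℂ)⁻¹ * powAnti ζ n θ) (u θ) := by
  induction θ using annih_induction Z with
  | one =>
    have single := hasSum_single (f := fun n : ℕ => (n.factorial : ℂ)⁻¹ * powAnti ζ n 1) 0
      fun n hn => by simp [powAnti_apply_one, hζ1, hn]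
    simpa [powAnti_apply_one, h1] using single
  | smul c θ h => simpa [mul_left_comm] using h.mul_left (conj c)
  | add θ η h k => simpa [mul_add] using h.add k
  | inc_mul v ψ h =>
    have vanish : powAnti ζ 0 (inc V v * ψ) = 0 := congr($(annih'_oneAnti v) ψ)
    rw [hu.apply, ← hasSum_nat_add_iff' 1]
    simp only [Finset.sum_range_one, vanish, mul_zero, sub_zero]
    refine h.congr_fun fun n => ?_
    have shift : powAnti ζ (n + 1) (inc V v * ψ) = ((n : ℂ) + 1) * powAnti ζ n (annih (Z v) ψ) :=
      congr($(annih'_powAnti_succ (hζ v) n) ψ)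
    have : (n : ℂ) + 1 ≠ 0 := by exact_mod_cast n.succ_ne_zero
    rw [shift, Nat.factorial_succ]
    push_cast
    field_simp

theorem GaussianEquation.isGaussian {Z : V →ₗ⋆[ℂ] V} {u : Antidual V}
    (hu : GaussianEquation Z u) (h1 : u 1 = 1) : IsGaussian Z u := by
  have quadratic : ∀ n, n ≠ 2 → ∀ θ ∈ homog V n, u.comp (homogProj 2) θ = 0 := by
    intro n hn θ hθ
    rw [LinearMap.comp_apply, homogProj_of_mem_of_ne hn.symm hθ, map_zero]
  refine ⟨u.comp (homogProj 2), quadratic, fun x y => ?_,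
    hu.hasSum_powAnti h1 (quadratic 0 two_ne_zero.symm 1 one_mem_homog)
      (hu.apply_homogProj_two h1)⟩
  have h := congr($(hu.apply_homogProj_two h1 x) (inc V y))
  simpa [annih'_apply, oneAnti_apply] using h

/-- The operators `c(v) + a(Zv)` on `SV`, which are the conjugates of the creators `c(v)` by the
(merely formal) operator `e^Z` on `SV`. -/
def gaussianCreat (Z : V →ₗ⋆[ℂ] V) : V →ₗ[ℂ] Module.End ℂ (Sym V) where
  toFun v := creat v + (annih (Z v)).toLinearMap
  map_add' v w := by
    ext ψ
    simp [creat, annih_add, add_mul]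
    abel
  map_smul' c v := by
    ext ψ
    simp [creat, annih_smul]

theorem gaussianCreat_apply (Z : V →ₗ⋆[ℂ] V) (v : V) (ψ : Sym V) :
    gaussianCreat Z v ψ = inc V v * ψ + annih (Z v) ψ := rfl

theorem IsSymmetricAnti.commute_gaussianCreat {Z : V →ₗ⋆[ℂ] V} (hZ : IsSymmetricAnti Z)
    (v w : V) : Commute (gaussianCreat Z v) (gaussianCreat Z w) := by
  ext ψ
  have : (inner ℂ (Z v) w : ℂ) = inner ℂ (Z w) v := by
    rw [← inner_conj_symm, hZ v w, inner_conj_symm]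
  simp only [Module.End.mul_apply, gaussianCreat_apply, map_add, annih_inc_mul]
  rw [annih_comm, mul_left_comm, this]
  abel

theorem exists_gaussianEquation {Z : V →ₗ⋆[ℂ] V} (hZ : IsSymmetricAnti Z) :
    ∃ u : Antidual V, u 1 = 1 ∧ GaussianEquation Z u := by
  set Q := symLiftOfCommute (gaussianCreat Z) hZ.commute_gaussianCreat
  have Q_inc_mul (v : V) (ψ : Sym V) :
      Q (inc V v * ψ) 1 = inc V v * Q ψ 1 + annih (Z v) (Q ψ 1) := by
    rw [map_mul, symLiftOfCommute_ι, Module.End.mul_apply, gaussianCreat_apply]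
  have annih_Q (x : V) (ψ : Sym V) : annih x (Q ψ 1) = Q (annih x ψ) 1 := by
    induction ψ using ι_mul_induction with
    | one => simp
    | smul c θ h =>
      rw [map_smul, LinearMap.smul_apply, Derivation.map_smul, h, Derivation.map_smul, map_smul,
        LinearMap.smul_apply]
    | add θ η h k => simp only [map_add, LinearMap.add_apply, h, k]
    | ι_mul v θ ih =>
      rw [Q_inc_mul, map_add, annih_inc_mul, annih_comm, ih, annih_inc_mul, map_add, map_smul,
        LinearMap.add_apply, Q_inc_mul, LinearMap.smul_apply, add_assoc]
  refine ⟨oneAnti.comp (LinearMap.applyₗ 1 ∘ₗ Q.toLinearMap), ?_, fun v => ?_⟩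
  · simp [oneAnti_apply]
  · ext ψ
    change oneAnti (Q (inc V v * ψ) 1) = oneAnti (Q (annih (Z v) ψ) 1)
    rw [Q_inc_mul, map_add, annih_Q]
    simp [oneAnti_apply]

theorem surjective_of_antilipschitz_of_orthogonal_eq_zero {𝕜 E F : Type*} [RCLike 𝕜]
    [NormedAddCommGroup E] [NormedSpace 𝕜 E] [CompleteSpace E] [NormedAddCommGroup F]
    [InnerProductSpace 𝕜 F] {σ : 𝕜 →+* 𝕜} [RingHomSurjective σ] (T : E →SL[σ] F) {K : NNReal}
    (hK : AntilipschitzWith K T) (horth : ∀ y, (∀ x, inner 𝕜 (T x) y = 0) → y = 0) :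
    Function.Surjective T := by
  have hcomplete : IsComplete (T.range : Set F) := by
    rw [LinearMap.coe_range]
    exact hK.isComplete_range T.uniformContinuous
  have := hcomplete.completeSpace_coe
  refine LinearMap.range_eq_top.1 (Submodule.orthogonal_eq_bot_iff.1 ?_)
  refine (Submodule.eq_bot_iff _).2 fun y hy => horth y fun x => ?_
  exact (Submodule.mem_orthogonal _ y).1 hy _ ⟨x, rfl⟩

/-! ### Antisymplectic automorphisms -/

section Antisymplectic

variable {V : Type*} [NormedAddCommGroup V] [InnerProductSpace ℂ V]

theorem re_inner_eq_im_inner_I_smul (x y : V) :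
    (inner ℂ x y).re = (inner ℂ x (Complex.I • y)).im := by
  simp

theorem eq_of_forall_im_inner_eq {x y : V}
    (h : ∀ z, (inner ℂ x z).im = (inner ℂ y z).im) : x = y :=
  ext_inner_right ℂ fun z => Complex.ext
    (by rw [re_inner_eq_im_inner_I_smul, h, re_inner_eq_im_inner_I_smul]) (h z)

theorem antiInv_apply_apply {A : V →ₗ⋆[ℂ] V} (h : Function.Bijective A) (v : V) :
    antiInv A (A v) = v := by
  rw [antiInv, dif_pos h]
  exact (LinearEquiv.ofBijective A h).symm_apply_apply v

theorem apply_antiInv_apply {A : V →ₗ⋆[ℂ] V} (h : Function.Bijective A) (v : V) :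
    A (antiInv A v) = v := by
  rw [antiInv, dif_pos h]
  exact (LinearEquiv.ofBijective A h).apply_symm_apply v

section Parts

variable (g : V ≃ₗ[ℝ] V)

theorem linPart_apply (v : V) :
    linPart g v = (2⁻¹ : ℂ) • (g v - Complex.I • g (Complex.I • v)) := rfl

theorem antiPart_apply (v : V) :
    antiPart g v = (2⁻¹ : ℂ) • (g v + Complex.I • g (Complex.I • v)) := rfl

theorem linPart_add_antiPart (v : V) : linPart g v + antiPart g v = g v := by
  rw [linPart_apply, antiPart_apply]
  module

theorem anticomm_eq_smul_linPart : anticomm g = (2 * Complex.I) • linPart g := by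
  ext v
  rw [LinearMap.smul_apply, linPart_apply]
  change g (Complex.I • v) + Complex.I • g v = _
  match_scalars
  · linear_combination Complex.I_sq
  · ring

theorem linPart_add_antiPart_linPart_add_antiPart_symm (v : V) :
    linPart g (linPart g.symm v) + linPart g (antiPart g.symm v) +
      (antiPart g (linPart g.symm v) + antiPart g (antiPart g.symm v)) = v := by
  rw [← map_add, ← map_add, linPart_add_antiPart, linPart_add_antiPart,
    LinearEquiv.apply_symm_apply]

/-- Replacing `v` by `iv` in `g g⁻¹ v = v` changes the sign of the antilinear terms. -/
theorem linPart_sub_antiPart_linPart_sub_antiPart_symm (v : V) :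
    linPart g (linPart g.symm v) - linPart g (antiPart g.symm v) +
      (-antiPart g (linPart g.symm v) + antiPart g (antiPart g.symm v)) = v := by
  have h := linPart_add_antiPart_linPart_add_antiPart_symm g (Complex.I • v)
  simp only [map_smulₛₗ, RingHom.id_apply, Complex.conj_I, map_neg, neg_neg] at h
  apply smul_right_injective V Complex.I_ne_zero
  simp only
  rw [← h]
  module

theorem linPart_linPart_symm_add_antiPart_antiPart_symm (v : V) :
    linPart g (linPart g.symm v) + antiPart g (antiPart g.symm v) = v := by
  linear_combination (norm := module)
    (2⁻¹ : ℂ) • linPart_add_antiPart_linPart_add_antiPart_symm g v +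
      (2⁻¹ : ℂ) • linPart_sub_antiPart_linPart_sub_antiPart_symm g v

theorem linPart_antiPart_symm_add_antiPart_linPart_symm (v : V) :
    linPart g (antiPart g.symm v) + antiPart g (linPart g.symm v) = 0 := by
  linear_combination (norm := module)
    (2⁻¹ : ℂ) • linPart_add_antiPart_linPart_add_antiPart_symm g v -
      (2⁻¹ : ℂ) • linPart_sub_antiPart_linPart_sub_antiPart_symm g v

end Parts

namespace IsAntisymplectic

variable {g : V ≃ₗ[ℝ] V}

theorem symm (hg : IsAntisymplectic g) : IsAntisymplectic g.symm := fun x y => by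
  have := hg (g.symm x) (g.symm y)
  simp only [LinearEquiv.apply_symm_apply] at this
  linarith

theorem im_inner (hg : IsAntisymplectic g) (x y : V) :
    (inner ℂ (g x) y).im = -(inner ℂ x (g.symm y)).im := by
  simpa using hg x (g.symm y)

theorem inner_linPart (hg : IsAntisymplectic g) (x y : V) :
    inner ℂ (linPart g x) y = -inner ℂ x (linPart g.symm y) := by
  have him (x y : V) :
      (inner ℂ (linPart g x) y).im = -(inner ℂ x (linPart g.symm y)).im := by
    have h₁ := hg.im_inner x y
    have h₂ := hg.im_inner (Complex.I • x) (Complex.I • y)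
    rw [inner_smul_right, inner_smul_left] at h₂
    simp only [linPart_apply, inner_smul_left, inner_smul_right, inner_sub_left, inner_sub_right]
    simp only [Complex.mul_im, Complex.mul_re, Complex.sub_im, Complex.sub_re, Complex.inv_re,
      Complex.inv_im, Complex.conj_re, Complex.conj_im, Complex.I_re, Complex.I_im,
      Complex.re_ofNat, Complex.im_ofNat, Complex.normSq_ofNat] at h₁ h₂ ⊢
    linarith
  apply Complex.ext
  · rw [re_inner_eq_im_inner_I_smul, him, Complex.neg_re, re_inner_eq_im_inner_I_smul, map_smul]
  · rw [him, Complex.neg_im]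

theorem inner_antiPart (hg : IsAntisymplectic g) (x y : V) :
    inner ℂ (antiPart g x) y = inner ℂ (antiPart g.symm y) x := by
  have him (x y : V) : (inner ℂ (antiPart g x) y).im = (inner ℂ (antiPart g.symm y) x).im := by
    have h₁ := hg.im_inner x y
    have h₂ := congrArg Complex.im (hg.inner_linPart x y)
    have h₃ : (inner ℂ (antiPart g.symm y) x).im = -(inner ℂ x (antiPart g.symm y)).im := by
      rw [← inner_conj_symm, Complex.conj_im]
    rw [← linPart_add_antiPart, ← linPart_add_antiPart g.symm, inner_add_left,
      inner_add_right] at h₁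
    simp only [Complex.add_im, Complex.neg_im] at h₁ h₂
    linarith
  apply Complex.ext
  · rw [re_inner_eq_im_inner_I_smul, him, map_smulₛₗ, inner_smul_left]
    simp
  · exact him x y

theorem norm_inner_linPart (hg : IsAntisymplectic g) (x y : V) :
    ‖inner ℂ x (linPart g y)‖ = ‖inner ℂ y (linPart g.symm x)‖ := by
  rw [norm_inner_symm, hg.inner_linPart, norm_neg]

theorem norm_antiPart_sq (hg : IsAntisymplectic g) (v : V) :
    ‖antiPart g v‖ ^ 2 = ‖v‖ ^ 2 + ‖linPart g v‖ ^ 2 := by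
  have h : inner ℂ (antiPart g v) (antiPart g v) =
      inner ℂ v v + inner ℂ (linPart g v) (linPart g v) := by
    have composition := linPart_linPart_symm_add_antiPart_antiPart_symm g.symm v
    have adjoint := hg.symm.inner_linPart (linPart g v) v
    rw [LinearEquiv.symm_symm] at composition adjoint
    rw [hg.inner_antiPart, eq_sub_of_add_eq' composition, inner_sub_left, adjoint, sub_neg_eq_add]
  simp only [inner_self_eq_norm_sq_to_K] at h
  exact_mod_cast h

theorem norm_le_norm_antiPart (hg : IsAntisymplectic g) (v : V) : ‖v‖ ≤ ‖antiPart g v‖ :=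
  le_of_sq_le_sq (by rw [hg.norm_antiPart_sq]; exact le_add_of_nonneg_right (sq_nonneg _))
    (norm_nonneg _)

theorem injective_antiPart (hg : IsAntisymplectic g) :
    Function.Injective (antiPart g) := by
  refine (injective_iff_map_eq_zero _).2 fun v hv => norm_le_zero_iff.1 ?_
  simpa [hv] using hg.norm_le_norm_antiPart v

section Complete

variable [CompleteSpace V]

theorem continuous (hg : IsAntisymplectic g) : Continuous g := by
  refine g.toLinearMap.continuous_of_seq_closed_graph fun x a y hx hy =>
    eq_of_forall_im_inner_eq fun z => ?_
  have h₁ : Filter.Tendsto (fun n => (inner ℂ (g (x n)) z).im) Filter.atTop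
      (nhds (inner ℂ y z).im) :=
    (Complex.continuous_im.tendsto _).comp (hy.inner tendsto_const_nhds)
  have h₂ : Filter.Tendsto (fun n => -(inner ℂ (x n) (g.symm z)).im) Filter.atTop
      (nhds (-(inner ℂ a (g.symm z)).im)) :=
    ((Complex.continuous_im.tendsto _).comp (hx.inner tendsto_const_nhds)).neg
  simp only [← hg.im_inner] at h₂
  exact tendsto_nhds_unique h₁ h₂

theorem continuous_linPart (hg : IsAntisymplectic g) : Continuous (linPart g) := by
  have := hg.continuous
  change Continuous fun v => (2⁻¹ : ℂ) • (g v - Complex.I • g (Complex.I • v))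
  fun_prop

theorem continuous_antiPart (hg : IsAntisymplectic g) : Continuous (antiPart g) := by
  have := hg.continuous
  change Continuous fun v => (2⁻¹ : ℂ) • (g v + Complex.I • g (Complex.I • v))
  fun_prop

theorem exists_one_le_forall_norm_antiPart_le (hg : IsAntisymplectic g) :
    ∃ K : ℝ, 1 ≤ K ∧ ∀ v, ‖antiPart g v‖ ≤ K * ‖v‖ := by
  let A : V →L⋆[ℂ] V := ⟨antiPart g, hg.continuous_antiPart⟩
  exact ⟨max 1 ‖A‖, le_max_left _ _, fun v => A.le_of_opNorm_le (le_max_right _ _) v⟩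

theorem bijective_antiPart (hg : IsAntisymplectic g) : Function.Bijective (antiPart g) := by
  have antilipschitz : AntilipschitzWith 1 (antiPart g) :=
    AddMonoidHomClass.antilipschitz_of_bound (antiPart g) fun v => by
      simpa using hg.norm_le_norm_antiPart v
  refine ⟨hg.injective_antiPart, surjective_of_antilipschitz_of_orthogonal_eq_zero
    ⟨antiPart g, hg.continuous_antiPart⟩ antilipschitz fun y hy => ?_⟩
  refine (map_eq_zero_iff _ hg.symm.injective_antiPart).1 (ext_inner_right ℂ fun x => ?_)
  rw [← hg.inner_antiPart, inner_zero_left]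
  exact hy x

theorem antiPart_zPart (hg : IsAntisymplectic g) (v : V) :
    antiPart g (zPart g v) = linPart g v :=
  apply_antiInv_apply hg.bijective_antiPart _

theorem zPart_antiPart_symm (hg : IsAntisymplectic g) (v : V) :
    zPart g (antiPart g.symm v) = -linPart g.symm v := by
  apply hg.injective_antiPart
  rw [hg.antiPart_zPart, map_neg]
  exact eq_neg_of_add_eq_zero_left (linPart_antiPart_symm_add_antiPart_linPart_symm g v)

theorem linPart_zPart_add_antiInv (hg : IsAntisymplectic g) (v : V) :
    linPart g (zPart g v) + antiInv (antiPart g.symm) v = antiPart g v := by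
  obtain ⟨b, rfl⟩ := hg.symm.bijective_antiPart.2 v
  rw [hg.zPart_antiPart_symm, antiInv_apply_apply hg.symm.bijective_antiPart, map_neg,
    neg_add_eq_iff_eq_add, linPart_linPart_symm_add_antiPart_antiPart_symm]

theorem inner_antiInv (hg : IsAntisymplectic g) (x y : V) :
    inner ℂ x (antiInv (antiPart g) y) = inner ℂ y (antiInv (antiPart g.symm) x) := by
  obtain ⟨a, rfl⟩ := hg.bijective_antiPart.2 y
  obtain ⟨b, rfl⟩ := hg.symm.bijective_antiPart.2 x
  rw [antiInv_apply_apply hg.bijective_antiPart, antiInv_apply_apply hg.symm.bijective_antiPart,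
    hg.inner_antiPart]

theorem isSymmetricAnti_zPart (hg : IsAntisymplectic g) : IsSymmetricAnti (zPart g) := by
  intro x y
  obtain ⟨b, rfl⟩ := hg.symm.bijective_antiPart.2 y
  rw [hg.zPart_antiPart_symm, ← hg.inner_antiPart, hg.antiPart_zPart, hg.inner_linPart,
    inner_neg_right]

/-- If `‖A_{g⁻¹}‖ ≤ K`, then `‖C_{g⁻¹} b‖² = ‖A_{g⁻¹} b‖² - ‖b‖² ≤ (1 - K⁻²) ‖A_{g⁻¹} b‖²`, and
`Z_g = -C_{g⁻¹} A_{g⁻¹}⁻¹`. -/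
theorem exists_lt_one_forall_norm_zPart_le (hg : IsAntisymplectic g) :
    ∃ k : ℝ, 0 ≤ k ∧ k < 1 ∧ ∀ v, ‖zPart g v‖ ≤ k * ‖v‖ := by
  obtain ⟨K, hK, hbound⟩ := hg.symm.exists_one_le_forall_norm_antiPart_le
  have pos : 0 < (K ^ 2)⁻¹ := by positivity
  have le_one : (K ^ 2)⁻¹ ≤ 1 := inv_le_one_of_one_le₀ (one_le_pow₀ hK)
  refine ⟨√(1 - (K ^ 2)⁻¹), Real.sqrt_nonneg _, ?_, fun v => ?_⟩
  · rw [Real.sqrt_lt' one_pos]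
    linarith
  · obtain ⟨b, rfl⟩ := hg.symm.bijective_antiPart.2 v
    have lower : (K ^ 2)⁻¹ * ‖antiPart g.symm b‖ ^ 2 ≤ ‖b‖ ^ 2 := by
      rw [inv_mul_le_iff₀ (by positivity), ← mul_pow]
      exact pow_le_pow_left₀ (norm_nonneg _) (hbound b) 2
    rw [hg.zPart_antiPart_symm, norm_neg]
    refine le_of_sq_le_sq ?_ (by positivity)
    rw [mul_pow, Real.sq_sqrt (sub_nonneg.2 le_one)]
    linarith [hg.symm.norm_antiPart_sq b]

end Complete

end IsAntisymplectic

end Antisymplectic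

/-! ### Metaplectic operators and their kernels -/

section Kernel

variable {V : Type*} [NormedAddCommGroup V] [InnerProductSpace ℂ V]

theorem inner_inc₁ (w : Double V) (v : V) : inner ℂ w (inc₁ v) = inner ℂ w.fst v := by
  rw [WithLp.prod_inner_apply]
  simp [inc₁]

theorem inner_inc₂ (w : Double V) (v : V) : inner ℂ w (inc₂ v) = inner ℂ w.snd v := by
  rw [WithLp.prod_inner_apply]
  simp [inc₂]

theorem sym₁_eq_symMap : sym₁ (V := V) = symMap inc₁ := rfl

theorem sym₂_eq_symMap : sym₂ (V := V) = symMap inc₂ := rfl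

theorem annih_sym₁_mul_sym₂ (w : Double V) (φ ψ : Sym V) :
    annih w (sym₁ φ * sym₂ ψ) = sym₁ (annih w.fst φ) * sym₂ ψ + sym₁ φ * sym₂ (annih w.snd ψ) := by
  rw [Derivation.leibniz, sym₁_eq_symMap, sym₂_eq_symMap,
    annih_symMap (inc₁ (V := V)) (p := fun w => w.fst) inner_inc₁,
    annih_symMap (inc₂ (V := V)) (p := fun w => w.snd) inner_inc₂, smul_eq_mul, smul_eq_mul,
    add_comm, mul_comm (symMap (inc₂ (V := V)) ψ)]

theorem kernelOp_apply (u : Antidual (Double V)) (φ ψ : Sym V) :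
    kernelOp u φ ψ = u (sym₁ φ * sym₂ ψ) := rfl

theorem kernelZ_inc₁ (g : V ≃ₗ[ℝ] V) (v : V) :
    kernelZ g (inc₁ v) = inc₁ (zPart g v) + inc₂ (antiInv (antiPart g.symm) v) := by
  simp [kernelZ, inc₁]

theorem kernelZ_inc₂ (g : V ≃ₗ[ℝ] V) (v : V) :
    kernelZ g (inc₂ v) = inc₁ (antiInv (antiPart g) v) + inc₂ (zPart g.symm v) := by
  simp [kernelZ, inc₂]

variable {g : V ≃ₗ[ℝ] V} {U T : Sym V →ₗ⋆[ℂ] Antidual V}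

/-- The differential equation of the Gaussian of `kernelZ g`, in terms of the map `SV → SV'` of
which it is the kernel. -/
structure KernelEquations (g : V ≃ₗ[ℝ] V) (U : Sym V →ₗ⋆[ℂ] Antidual V) : Prop where
  inc_mul : ∀ v φ ψ, U (inc V v * φ) ψ =
    U (annih (zPart g v) φ) ψ + U φ (annih (antiInv (antiPart g.symm) v) ψ)
  apply_inc_mul : ∀ v φ ψ, U φ (inc V v * ψ) =
    U (annih (antiInv (antiPart g) v) φ) ψ + U φ (annih (zPart g.symm v) ψ)

theorem GaussianEquation.kernelEquations {u : Antidual (Double V)}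
    (hu : GaussianEquation (kernelZ g) u) : KernelEquations g (kernelOp u) where
  inc_mul v φ ψ := by
    rw [kernelOp_apply, map_mul sym₁, sym₁_eq_symMap, symMap_ι, ← sym₁_eq_symMap, mul_assoc,
      hu.apply, annih_sym₁_mul_sym₂, map_add, kernelZ_inc₁]
    simp [inc₁, inc₂, kernelOp_apply]
  apply_inc_mul v φ ψ := by
    rw [kernelOp_apply, map_mul sym₂, sym₂_eq_symMap, symMap_ι, ← sym₂_eq_symMap, mul_left_comm,
      hu.apply, annih_sym₁_mul_sym₂, map_add, kernelZ_inc₂]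
    simp [inc₁, inc₂, kernelOp_apply]

theorem KernelEquations.flip (hU : KernelEquations g U) : KernelEquations g.symm U.flip where
  inc_mul v φ ψ := by
    simp only [LinearMap.flip_apply, LinearEquiv.symm_symm]
    rw [hU.apply_inc_mul, add_comm]
  apply_inc_mul v φ ψ := by
    simp only [LinearMap.flip_apply, LinearEquiv.symm_symm]
    rw [hU.inc_mul, add_comm]

theorem KernelEquations.gaussianEquation_apply_one (hU : KernelEquations g U) :
    GaussianEquation (zPart g.symm) (U 1) := fun v => by
  ext ψ
  simpa [annih'_apply] using hU.apply_inc_mul v 1 ψ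

theorem IsWeakMetaplectic.smul (hU : IsWeakMetaplectic g U) {c : ℂ} (hc : c ≠ 0) :
    IsWeakMetaplectic g (c • U) := by
  refine ⟨smul_ne_zero hc hU.1, fun v φ => ?_, fun v φ => ?_⟩
  · simp only [LinearMap.smul_apply, hU.2.1, map_smul, smul_add]
  · simp only [LinearMap.smul_apply, hU.2.2, map_smul, smul_add]

variable [CompleteSpace V]

theorem IsAntisymplectic.isSymmetricAnti_kernelZ (hg : IsAntisymplectic g) :
    IsSymmetricAnti (kernelZ g) := by
  have kernelZ_apply (w : Double V) : kernelZ g w =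
      (inc₁ (zPart g w.fst) + inc₂ (antiInv (antiPart g.symm) w.fst)) +
        (inc₁ (antiInv (antiPart g) w.snd) + inc₂ (zPart g.symm w.snd)) := rfl
  intro x y
  simp only [kernelZ_apply, inner_add_right, inner_inc₁, inner_inc₂]
  rw [hg.isSymmetricAnti_zPart x.fst, hg.symm.isSymmetricAnti_zPart x.snd,
    hg.inner_antiInv y.fst, ← hg.inner_antiInv x.fst]
  ring

theorem KernelEquations.map_annih (hg : IsAntisymplectic g) (hU : KernelEquations g U) (v : V)
    (φ : Sym V) :
    U (annih v φ) = annih' (antiPart g v) (U φ) + creat' (linPart g v) (U φ) := by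
  ext ψ
  have h := hU.apply_inc_mul (antiPart g v) φ ψ
  have zPart_symm := hg.symm.zPart_antiPart_symm v
  rw [LinearEquiv.symm_symm] at zPart_symm
  rw [antiInv_apply_apply hg.bijective_antiPart, zPart_symm, ← neg_one_smul ℂ, annih_smul] at h
  rw [LinearMap.add_apply, annih'_apply, creat'_apply, h]
  simp

theorem KernelEquations.map_creat (hg : IsAntisymplectic g) (hU : KernelEquations g U) (v : V)
    (φ : Sym V) :
    U (creat v φ) = annih' (linPart g v) (U φ) + creat' (antiPart g v) (U φ) := by
  ext ψ
  change U (inc V v * φ) ψ = _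
  rw [hU.inc_mul, hU.map_annih hg, hg.antiPart_zPart, LinearMap.add_apply, LinearMap.add_apply,
    creat'_apply, creat'_apply, ← hg.linPart_zPart_add_antiInv v, annih_add, Derivation.add_apply,
    map_add, add_assoc]

theorem KernelEquations.isWeakMetaplectic (hg : IsAntisymplectic g) (hU : KernelEquations g U)
    (hU0 : U ≠ 0) : IsWeakMetaplectic g U :=
  ⟨hU0, hU.map_creat hg, hU.map_annih hg⟩

theorem IsAntisymplectic.eq_zero_of_intertwines (hg : IsAntisymplectic g) (h0 : U 1 1 = 0)
    (hc : ∀ v φ, U (creat v φ) = annih' (linPart g v) (U φ) + creat' (antiPart g v) (U φ))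
    (ha : ∀ v φ, U (annih v φ) = annih' (antiPart g v) (U φ) + creat' (linPart g v) (U φ)) :
    U = 0 := by
  have vacuum_inc_mul (v : V) (ψ : Sym V) :
      U 1 (inc V v * ψ) = U 1 (annih (-linPart g (antiInv (antiPart g) v)) ψ) := by
    have h := congr($(ha (antiInv (antiPart g) v) 1) ψ)
    rw [Derivation.map_one_eq_zero, map_zero, LinearMap.add_apply, creat'_apply, annih'_apply,
      apply_antiInv_apply hg.bijective_antiPart, LinearMap.zero_apply] at h
    rw [← neg_one_smul ℂ (linPart g _), annih_smul]
    simpa using eq_neg_of_add_eq_zero_left h.symm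
  have vacuum (ψ : Sym V) : U 1 ψ = 0 := by
    induction ψ using annih_induction fun v => -linPart g (antiInv (antiPart g) v) with
    | one => exact h0
    | smul c θ h => rw [map_smulₛₗ, h, smul_zero]
    | add θ η h k => rw [map_add, h, k, add_zero]
    | inc_mul v ψ h => rw [vacuum_inc_mul, h]
  ext φ : 1
  rw [LinearMap.zero_apply]
  induction φ using ι_mul_induction with
  | one => exact LinearMap.ext vacuum
  | smul c θ h => rw [map_smulₛₗ, h, smul_zero]
  | add θ η h k => rw [map_add, h, k, add_zero]
  | ι_mul v θ h =>
    have := hc v θ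
    rw [h, map_zero, map_zero, add_zero] at this
    exact this

theorem IsAntisymplectic.exists_eq_smul (hg : IsAntisymplectic g) (hU : IsWeakMetaplectic g U)
    (hT : IsWeakMetaplectic g T) (h1 : T 1 1 = 1) : ∃ c : ℂ, c ≠ 0 ∧ U = c • T := by
  have h : U - U 1 1 • T = 0 := by
    refine hg.eq_zero_of_intertwines ?_ (fun v φ => ?_) fun v φ => ?_
    · simp [h1]
    · simp only [LinearMap.sub_apply, LinearMap.smul_apply, hU.2.1, hT.2.1, map_sub, map_smul]
      module
    · simp only [LinearMap.sub_apply, LinearMap.smul_apply, hU.2.2, hT.2.2, map_sub, map_smul]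
      module
  rw [sub_eq_zero] at h
  refine ⟨U 1 1, fun h0 => hU.1 ?_, h⟩
  rw [h, h0, zero_smul]

end Kernel

section SymmetricFock

variable {V : Type*} [NormedAddCommGroup V] [InnerProductSpace ℂ V]

/-! ### The inner product of the symmetric algebra -/

theorem innerS_zero_left (φ : Sym V) : innerS 0 φ = 0 := map_zero (embed φ)

theorem innerS_zero_right (ψ : Sym V) : innerS ψ 0 = 0 := by
  rw [innerS, map_zero, LinearMap.zero_apply]

theorem innerS_add_left (ψ θ φ : Sym V) : innerS (ψ + θ) φ = innerS ψ φ + innerS θ φ :=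
  map_add (embed φ) ψ θ

theorem innerS_add_right (ψ φ θ : Sym V) : innerS ψ (φ + θ) = innerS ψ φ + innerS ψ θ := by
  rw [innerS, map_add, LinearMap.add_apply, ← innerS, ← innerS]

theorem innerS_smul_left (c : ℂ) (ψ φ : Sym V) : innerS (c • ψ) φ = conj c * innerS ψ φ :=
  map_smulₛₗ (embed φ) c ψ

theorem innerS_smul_right (c : ℂ) (ψ φ : Sym V) : innerS ψ (c • φ) = c * innerS ψ φ := by
  rw [innerS, map_smulₛₗ, LinearMap.smul_apply, ← innerS, RingHom.id_apply, smul_eq_mul]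

theorem innerS_sum_right {ι : Type*} (s : Finset ι) (f : ι → Sym V) (ψ : Sym V) :
    innerS ψ (∑ i ∈ s, f i) = ∑ i ∈ s, innerS ψ (f i) := by
  simp only [innerS, map_sum, LinearMap.sum_apply]

theorem innerS_inc_mul_left (v : V) (ψ φ : Sym V) :
    innerS (inc V v * ψ) φ = innerS ψ (annih v φ) := by
  induction φ using ι_mul_induction generalizing ψ with
  | one => rw [innerS_one, counit_inc_mul, map_zero, Derivation.map_one_eq_zero, innerS_zero_right]
  | smul c θ h => rw [innerS_smul_right, h, Derivation.map_smul, innerS_smul_right]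
  | add θ η h k => rw [innerS_add_right, h, k, map_add, innerS_add_right]
  | ι_mul w θ ih =>
    rw [innerS_inc_mul, annih_inc_mul, annih_inc_mul, innerS_add_left, innerS_smul_left, ih,
      inner_conj_symm, innerS_add_right, innerS_smul_right, innerS_inc_mul]

theorem innerS_one_left (φ : Sym V) : innerS 1 φ = Coalgebra.counit (R := ℂ) φ := by
  induction φ using ι_mul_induction with
  | one => simp [innerS_one]
  | smul c θ h => rw [innerS_smul_right, h, map_smul, smul_eq_mul]
  | add θ η h k => rw [innerS_add_right, h, k, map_add]
  | ι_mul w θ =>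
    rw [innerS_inc_mul, counit_inc_mul, Derivation.map_one_eq_zero, innerS_zero_left]

theorem innerS_conj_symm (ψ φ : Sym V) : conj (innerS φ ψ) = innerS ψ φ := by
  induction φ using ι_mul_induction generalizing ψ with
  | one => rw [innerS_one_left, innerS_one]
  | smul c θ h => rw [innerS_smul_left, map_mul, h, Complex.conj_conj, innerS_smul_right]
  | add θ η h k => rw [innerS_add_left, map_add, h, k, innerS_add_right]
  | ι_mul w θ ih => rw [innerS_inc_mul_left, ih, innerS_inc_mul]

theorem counit_homogProj_succ (n : ℕ) (ψ : Sym V) :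
    Coalgebra.counit (R := ℂ) (homogProj (n + 1) ψ) = 0 := by
  have h := homogProj_zero (homogProj (n + 1) ψ)
  rw [homogProj_of_mem_of_ne n.succ_ne_zero.symm (homogProj_mem (n + 1) ψ)] at h
  exact (map_eq_zero_iff _ (algebraMap ℂ (Sym V)).injective).1 h.symm

theorem innerS_homogProj_left (n : ℕ) (ψ φ : Sym V) :
    innerS (homogProj n ψ) φ = innerS ψ (homogProj n φ) := by
  induction φ using ι_mul_induction generalizing n ψ with
  | one =>
    cases n with
    | zero =>
      rw [homogProj_zero, homogProj_zero_one, innerS_one, innerS_one, Bialgebra.counit_algebraMap]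
    | succ n =>
      rw [homogProj_succ_one, innerS_zero_right, innerS_one, counit_homogProj_succ, map_zero]
  | smul c θ h => rw [innerS_smul_right, h, map_smul, innerS_smul_right]
  | add θ η h k => rw [innerS_add_right, h, k, map_add, innerS_add_right]
  | ι_mul w θ ih =>
    rw [innerS_inc_mul]
    cases n with
    | zero =>
      rw [annih_of_mem_homog_zero w (homogProj_mem 0 ψ), homogProj_zero_ι_mul, innerS_zero_left,
        innerS_zero_right]
    | succ n => rw [← homogProj_annih, ih, homogProj_succ_ι_mul, innerS_inc_mul]

theorem innerS_homogProj_self (n : ℕ) (ψ : Sym V) :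
    innerS (homogProj n ψ) (homogProj n ψ) = innerS ψ (homogProj n ψ) := by
  rw [innerS_homogProj_left, homogProj_of_mem (homogProj_mem n ψ)]

theorem sum_inc_mul_annih {ι : Type*} [Fintype ι] (e : OrthonormalBasis ι ℂ V) {n : ℕ}
    {ψ : Sym V} (hψ : ψ ∈ homog V n) : ∑ k, inc V (e k) * annih (e k) ψ = (n : ℂ) • ψ := by
  induction n generalizing ψ with
  | zero => simp [annih_of_mem_homog_zero _ hψ]
  | succ n ih =>
    rw [homog, pow_succ'] at hψ
    refine Submodule.mul_induction_on hψ ?_ fun θ η hθ hη => by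
      simp only [map_add, mul_add, Finset.sum_add_distrib, hθ, hη, smul_add]
    rintro _ ⟨w, rfl⟩ θ hθ
    change ∑ k, inc V (e k) * annih (e k) (inc V w * θ) = ((n + 1 : ℕ) : ℂ) • (inc V w * θ)
    calc ∑ k, inc V (e k) * annih (e k) (inc V w * θ)
        = inc V (∑ k, inner ℂ (e k) w • e k) * θ +
            inc V w * ∑ k, inc V (e k) * annih (e k) θ := by
          simp only [annih_inc_mul, mul_add, Finset.sum_add_distrib, map_sum, map_smul,
            Finset.sum_mul, Finset.mul_sum, smul_mul_assoc, mul_smul_comm,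
            mul_left_comm (inc V w)]
      _ = ((n + 1 : ℕ) : ℂ) • (inc V w * θ) := by
          rw [e.sum_repr', ih hθ, mul_smul_comm, Nat.cast_succ, add_smul, one_smul, add_comm]

theorem natCast_mul_innerS_self {ι : Type*} [Fintype ι] (e : OrthonormalBasis ι ℂ V) {n : ℕ}
    {ψ : Sym V} (hψ : ψ ∈ homog V n) :
    (n : ℂ) * innerS ψ ψ = ∑ k, innerS (annih (e k) ψ) (annih (e k) ψ) := by
  rw [← innerS_smul_right, ← sum_inc_mul_annih e hψ, innerS_sum_right]
  simp only [innerS_inc_mul]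

theorem innerS_self_re_pos_of_mem_homog [FiniteDimensional ℂ V] {n : ℕ} {ψ : Sym V}
    (hψ : ψ ∈ homog V n) (h0 : ψ ≠ 0) : 0 < (innerS ψ ψ).re := by
  induction n generalizing ψ with
  | zero =>
    rw [homog, pow_zero] at hψ
    obtain ⟨c, rfl⟩ := Submodule.mem_one.1 hψ
    rw [Algebra.algebraMap_eq_smul_one, innerS_smul_left, innerS_smul_right, innerS_one,
      Bialgebra.counit_one, map_one, mul_one, mul_comm, Complex.mul_conj, Complex.ofReal_re,
      Complex.normSq_pos]
    rintro rfl
    exact h0 (map_zero _)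
  | succ n ih =>
    let e := stdOrthonormalBasis ℂ V
    have hnonneg (k) : 0 ≤ (innerS (annih (e k) ψ) (annih (e k) ψ)).re := by
      by_cases hk : annih (e k) ψ = 0
      · rw [hk, innerS_zero_left, Complex.zero_re]
      · exact (ih (annih_mem_homog n (e k) hψ) hk).le
    obtain ⟨k, hk⟩ : ∃ k, annih (e k) ψ ≠ 0 := by
      by_contra! h
      refine smul_ne_zero (Nat.cast_ne_zero.2 n.succ_ne_zero) h0
        ((sum_inc_mul_annih e hψ).symm.trans ?_)
      exact Finset.sum_eq_zero fun k _ => by rw [h k, mul_zero]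
    have hsum := congrArg Complex.re (natCast_mul_innerS_self e hψ)
    rw [← Complex.ofReal_natCast, Complex.re_ofReal_mul, Complex.re_sum] at hsum
    refine pos_of_mul_pos_right (hsum ▸ ?_) (Nat.cast_nonneg (n + 1))
    exact Finset.sum_pos' (fun k _ => hnonneg k)
      ⟨k, Finset.mem_univ k, ih (annih_mem_homog n (e k) hψ) hk⟩

theorem innerS_self_re_pos_of_finiteDimensional [FiniteDimensional ℂ V] {ψ : Sym V}
    (h0 : ψ ≠ 0) : 0 < (innerS ψ ψ).re := by
  obtain ⟨N, hN⟩ := exists_sum_homogProj_eq ψ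
  have hsum : (innerS ψ ψ).re =
      ∑ n ∈ Finset.range N, (innerS (homogProj n ψ) (homogProj n ψ)).re := by
    simp only [innerS_homogProj_self, ← Complex.re_sum, ← innerS_sum_right, hN]
  have hnonneg (n) : 0 ≤ (innerS (homogProj n ψ) (homogProj n ψ)).re := by
    by_cases hn : homogProj n ψ = 0
    · rw [hn, innerS_zero_left, Complex.zero_re]
    · exact (innerS_self_re_pos_of_mem_homog (homogProj_mem n ψ) hn).le
  obtain ⟨n, hn, hne⟩ := Finset.exists_ne_zero_of_sum_ne_zero (hN.trans_ne h0)
  rw [hsum]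
  exact Finset.sum_pos' (fun n _ => hnonneg n)
    ⟨n, hn, innerS_self_re_pos_of_mem_homog (homogProj_mem n ψ) hne⟩

theorem innerS_symMap_subtype (F : Submodule ℂ V) [F.HasOrthogonalProjection] (ψ φ : Sym F) :
    innerS (symMap F.subtype ψ) (symMap F.subtype φ) = innerS ψ φ := by
  have h : (F.orthogonalProjectionOnto : V →ₗ[ℂ] F) ∘ₗ F.subtype = LinearMap.id := by
    ext x; simp
  rw [innerS_symMap F.subtype (F.orthogonalProjectionOnto : V →ₗ[ℂ] F) (fun v w => by simp),
    ← AlgHom.comp_apply, symMap_comp, h, symMap_id, AlgHom.id_apply]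

theorem innerS_self_re_pos {ψ : Sym V} (h0 : ψ ≠ 0) : 0 < (innerS ψ ψ).re := by
  obtain ⟨F, hF, η, rfl⟩ := exists_fg_mem_range_symMap_subtype ψ
  have : FiniteDimensional ℂ F := Module.Finite.iff_fg.2 hF
  have hη : η ≠ 0 := by rintro rfl; exact h0 (map_zero _)
  exact (innerS_symMap_subtype F η η).symm ▸ innerS_self_re_pos_of_finiteDimensional hη

theorem innerS_self_re_nonneg (ψ : Sym V) : 0 ≤ (innerS ψ ψ).re := by
  by_cases h : ψ = 0
  · rw [h, innerS_zero_left, Complex.zero_re]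
  · exact (innerS_self_re_pos h).le

/-- The canonical inner product `innerS` makes `SV` a pre-Hilbert space. -/
@[reducible]
def symCore (V : Type*) [NormedAddCommGroup V] [InnerProductSpace ℂ V] :
    InnerProductSpace.Core ℂ (Sym V) where
  inner := innerS
  conj_inner_symm := innerS_conj_symm
  re_inner_nonneg := innerS_self_re_nonneg
  add_left := innerS_add_left
  smul_left ψ φ c := innerS_smul_left c ψ φ
  definite ψ h := by
    by_contra h0
    exact (innerS_self_re_pos h0).ne' (congrArg Complex.re h)

/-- The norm of `SV` coming from `innerS`; only a local instance. -/
abbrev symNormedAddCommGroup : NormedAddCommGroup (Sym V) :=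
  (symCore V).toNormedAddCommGroup

attribute [local instance] symNormedAddCommGroup

/-- The inner product `innerS` of `SV`; only a local instance. -/
abbrev symInnerProductSpace : InnerProductSpace ℂ (Sym V) :=
  InnerProductSpace.ofCore (symCore V).toCore

attribute [local instance] symInnerProductSpace

theorem sqrt_innerS_self (ψ : Sym V) : √(innerS ψ ψ).re = ‖ψ‖ := rfl

theorem inner_inc_mul_right (v : V) (ψ φ : Sym V) :
    inner ℂ ψ (inc V v * φ) = inner ℂ (annih v ψ) φ := innerS_inc_mul v ψ φ

theorem inner_inc_mul_left (v : V) (ψ φ : Sym V) :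
    inner ℂ (inc V v * ψ) φ = inner ℂ ψ (annih v φ) := innerS_inc_mul_left v ψ φ

theorem norm_one_sym : ‖(1 : Sym V)‖ = 1 := by
  rw [← sqrt_innerS_self, innerS_one]
  simp

theorem norm_inc_mul_sq (v : V) (ψ : Sym V) :
    ‖inc V v * ψ‖ ^ 2 = ‖v‖ ^ 2 * ‖ψ‖ ^ 2 + ‖annih v ψ‖ ^ 2 := by
  have h : inner ℂ (inc V v * ψ) (inc V v * ψ) =
      inner ℂ v v * inner ℂ ψ ψ + inner ℂ (annih v ψ) (annih v ψ) := by
    rw [inner_inc_mul_left, annih_inc_mul, inner_add_right, inner_smul_right, inner_inc_mul_right]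
  simp only [inner_self_eq_norm_sq_to_K] at h
  exact_mod_cast h

theorem norm_annih_sq_le_mul (v : V) (ψ : Sym V) :
    ‖annih v ψ‖ ^ 2 ≤ ‖ψ‖ * ‖inc V v * annih v ψ‖ := by
  have h := norm_inner_le_norm (𝕜 := ℂ) ψ (inc V v * annih v ψ)
  rwa [inner_inc_mul_right, inner_self_eq_norm_sq_to_K, norm_pow, RCLike.norm_ofReal,
    abs_norm] at h

theorem norm_annih_sq_le {n : ℕ} (v : V) {ψ : Sym V} (hψ : ψ ∈ homog V n) :
    ‖annih v ψ‖ ^ 2 ≤ n * ‖v‖ ^ 2 * ‖ψ‖ ^ 2 := by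
  induction n generalizing ψ with
  | zero => simp [annih_of_mem_homog_zero v hψ]
  | succ n ih =>
    have h : (‖annih v ψ‖ ^ 2) ^ 2 ≤ ((n + 1 : ℕ) * ‖v‖ ^ 2 * ‖ψ‖ ^ 2) * ‖annih v ψ‖ ^ 2 := by
      calc (‖annih v ψ‖ ^ 2) ^ 2 ≤ (‖ψ‖ * ‖inc V v * annih v ψ‖) ^ 2 :=
            pow_le_pow_left₀ (by positivity) (norm_annih_sq_le_mul v ψ) 2
        _ = ‖ψ‖ ^ 2 * (‖v‖ ^ 2 * ‖annih v ψ‖ ^ 2 + ‖annih v (annih v ψ)‖ ^ 2) := by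
            rw [mul_pow, norm_inc_mul_sq]
        _ ≤ ‖ψ‖ ^ 2 * (‖v‖ ^ 2 * ‖annih v ψ‖ ^ 2 + n * ‖v‖ ^ 2 * ‖annih v ψ‖ ^ 2) := by
            gcongr
            exact ih (annih_mem_homog n v hψ)
        _ = ((n + 1 : ℕ) * ‖v‖ ^ 2 * ‖ψ‖ ^ 2) * ‖annih v ψ‖ ^ 2 := by push_cast; ring
    rcases (sq_nonneg ‖annih v ψ‖).eq_or_lt with h0 | h0
    · rw [← h0]; positivity
    · exact le_of_mul_le_mul_right (by rwa [← sq]) h0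

theorem norm_annih_le {n : ℕ} (v : V) {ψ : Sym V} (hψ : ψ ∈ homog V n) :
    ‖annih v ψ‖ ≤ (n + 1) * ‖v‖ * ‖ψ‖ := by
  refine le_of_sq_le_sq ((norm_annih_sq_le v hψ).trans ?_) (by positivity)
  rw [mul_pow, mul_pow]
  gcongr
  nlinarith [(Nat.cast_nonneg n : (0 : ℝ) ≤ n)]

theorem norm_inc_mul_le {n : ℕ} (v : V) {ψ : Sym V} (hψ : ψ ∈ homog V n) :
    ‖inc V v * ψ‖ ≤ (n + 1) * ‖v‖ * ‖ψ‖ := by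
  refine le_of_sq_le_sq ?_ (by positivity)
  calc ‖inc V v * ψ‖ ^ 2 = ‖v‖ ^ 2 * ‖ψ‖ ^ 2 + ‖annih v ψ‖ ^ 2 := norm_inc_mul_sq v ψ
    _ ≤ ‖v‖ ^ 2 * ‖ψ‖ ^ 2 + n * ‖v‖ ^ 2 * ‖ψ‖ ^ 2 := by gcongr; exact norm_annih_sq_le v hψ
    _ = (n + 1) * (‖v‖ * ‖ψ‖) ^ 2 := by ring
    _ ≤ (n + 1) ^ 2 * (‖v‖ * ‖ψ‖) ^ 2 := by
        gcongr
        nlinarith [(Nat.cast_nonneg n : (0 : ℝ) ≤ n)]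
    _ = ((n + 1) * ‖v‖ * ‖ψ‖) ^ 2 := by ring

theorem norm_homogProj_le (n : ℕ) (ψ : Sym V) : ‖homogProj n ψ‖ ≤ ‖ψ‖ := by
  have h := norm_inner_le_norm (𝕜 := ℂ) ψ (homogProj n ψ)
  rw [show inner ℂ ψ (homogProj n ψ) = inner ℂ (homogProj n ψ) (homogProj n ψ) from
    (innerS_homogProj_self n ψ).symm, inner_self_eq_norm_sq_to_K, norm_pow,
    RCLike.norm_ofReal, abs_norm, sq] at h
  rcases (norm_nonneg (homogProj n ψ)).eq_or_lt with h0 | h0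
  · exact h0 ▸ norm_nonneg ψ
  · exact le_of_mul_le_mul_right h h0

/-! ### Dilations -/

/-- The dilation `r^N`, with `N` the number operator. -/
def dil (r : ℝ) : Sym V →ₐ[ℂ] Sym V := symMap ((r : ℂ) • LinearMap.id)

theorem dil_inc (r : ℝ) (v : V) : dil r (inc V v) = (r : ℂ) • inc V v := by
  rw [dil, symMap_ι, LinearMap.smul_apply, map_smul, LinearMap.id_apply]

theorem annih_dil (r : ℝ) (v : V) (ψ : Sym V) :
    annih v (dil r ψ) = (r : ℂ) • dil r (annih v ψ) := by
  rw [dil, annih_symMap (p := fun v => (r : ℂ) • v) _ (fun v w => by simp), annih_smul,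
    Complex.conj_ofReal, Derivation.smul_apply, map_smul]

theorem inner_dil (r : ℝ) (ψ φ : Sym V) : inner ℂ (dil r ψ) φ = inner ℂ ψ (dil r φ) :=
  innerS_symMap _ _ (fun v w => by simp) ψ φ

theorem dil_dil (r s : ℝ) (ψ : Sym V) : dil r (dil s ψ) = dil (r * s) ψ := by
  rw [dil, dil, ← AlgHom.comp_apply, symMap_comp, dil]
  congr 2
  ext v
  simp only [LinearMap.comp_apply, LinearMap.smul_apply, LinearMap.id_apply, smul_smul,
    Complex.ofReal_mul]

theorem dil_one (ψ : Sym V) : dil 1 ψ = ψ := by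
  rw [dil, Complex.ofReal_one, one_smul, symMap_id, AlgHom.id_apply]

theorem dil_of_mem_homog (r : ℝ) {n : ℕ} {ψ : Sym V} (hψ : ψ ∈ homog V n) :
    dil r ψ = (r : ℂ) ^ n • ψ := by
  induction n generalizing ψ with
  | zero =>
    rw [homog, pow_zero] at hψ
    obtain ⟨c, rfl⟩ := Submodule.mem_one.1 hψ
    rw [AlgHom.commutes, pow_zero, one_smul]
  | succ n ih =>
    rw [homog, pow_succ'] at hψ
    refine Submodule.mul_induction_on hψ ?_ fun θ η hθ hη => by rw [map_add, hθ, hη, smul_add]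
    rintro _ ⟨w, rfl⟩ θ hθ
    change dil r (inc V w * θ) = (r : ℂ) ^ (n + 1) • (inc V w * θ)
    rw [map_mul, dil_inc, ih hθ, smul_mul_smul_comm, pow_succ']

theorem norm_map_dil_le (L : Sym V →ₗ[ℂ] Sym V) {B r : ℝ}
    (hL : ∀ n, ∀ ψ ∈ homog V n, ‖L ψ‖ ≤ (n + 1) * B * ‖ψ‖) (hB : 0 ≤ B) (h0 : 0 ≤ r) (h1 : r < 1)
    (ψ : Sym V) : ‖L (dil r ψ)‖ ≤ (∑' n : ℕ, (n + 1) * r ^ n) * B * ‖ψ‖ := by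
  have hs : Summable fun n : ℕ => ((n : ℝ) + 1) * r ^ n := by
    simpa only [pow_one, add_mul, one_mul] using (summable_pow_mul_geometric_of_norm_lt_one 1
      (by rwa [Real.norm_of_nonneg h0])).add (summable_geometric_of_lt_one h0 h1)
  obtain ⟨N, hN⟩ := exists_sum_homogProj_eq ψ
  calc ‖L (dil r ψ)‖ = ‖∑ n ∈ Finset.range N, (r : ℂ) ^ n • L (homogProj n ψ)‖ := by
        conv_lhs => rw [← hN]
        simp only [map_sum, dil_of_mem_homog r (homogProj_mem _ ψ), map_smul]
    _ ≤ ∑ n ∈ Finset.range N, (n + 1) * r ^ n * (B * ‖ψ‖) := by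
        refine (norm_sum_le _ _).trans (Finset.sum_le_sum fun n _ => ?_)
        rw [norm_smul, norm_pow, Complex.norm_real, Real.norm_of_nonneg h0]
        calc r ^ n * ‖L (homogProj n ψ)‖ ≤ r ^ n * ((n + 1) * B * ‖ψ‖) := by
              gcongr
              exact (hL n _ (homogProj_mem n ψ)).trans (by gcongr; exact norm_homogProj_le n ψ)
          _ = (n + 1) * r ^ n * (B * ‖ψ‖) := by ring
    _ ≤ (∑' n : ℕ, (n + 1) * r ^ n) * (B * ‖ψ‖) := by
        rw [← Finset.sum_mul]
        gcongr
        exact hs.sum_le_tsum _ fun n _ => by positivity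
    _ = (∑' n : ℕ, (n + 1) * r ^ n) * B * ‖ψ‖ := by ring

/-- Dilating by `r < 1` tames any operator of linear growth in the degree. -/
theorem exists_bound_map_dil (L : Sym V →ₗ[ℂ] Sym V) {B r : ℝ}
    (hL : ∀ n, ∀ ψ ∈ homog V n, ‖L ψ‖ ≤ (n + 1) * B * ‖ψ‖) (hB : 0 ≤ B) (h0 : 0 ≤ r)
    (h1 : r < 1) : ∃ K, 0 ≤ K ∧ ∀ ψ, ‖L (dil r ψ)‖ ≤ K * ‖ψ‖ :=
  ⟨_, mul_nonneg (tsum_nonneg fun n => by positivity) hB, norm_map_dil_le L hL hB h0 h1⟩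

theorem exists_bound_dil {r : ℝ} (h0 : 0 ≤ r) (h1 : r < 1) :
    ∃ K, 0 ≤ K ∧ ∀ ψ : Sym V, ‖dil r ψ‖ ≤ K * ‖ψ‖ :=
  exists_bound_map_dil LinearMap.id (fun n ψ _ => by
    rw [mul_one]
    exact le_mul_of_one_le_left (norm_nonneg ψ) (by linarith [(Nat.cast_nonneg n : (0 : ℝ) ≤ n)]))
    zero_le_one h0 h1

theorem exists_bound_annih_dil (v : V) {r : ℝ} (h0 : 0 ≤ r) (h1 : r < 1) :
    ∃ K, 0 ≤ K ∧ ∀ ψ : Sym V, ‖annih v (dil r ψ)‖ ≤ K * ‖ψ‖ :=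
  exists_bound_map_dil (annih v).toLinearMap (fun _ _ => norm_annih_le v) (norm_nonneg v) h0 h1

theorem exists_bound_inc_mul_dil (v : V) {r : ℝ} (h0 : 0 ≤ r) (h1 : r < 1) :
    ∃ K, 0 ≤ K ∧ ∀ ψ : Sym V, ‖inc V v * dil r ψ‖ ≤ K * ‖ψ‖ :=
  exists_bound_map_dil (creat v) (fun _ _ => norm_inc_mul_le v) (norm_nonneg v) h0 h1

/-! ### Fock space as the completion of the symmetric algebra -/

open UniformSpace in
/-- The Hilbert space completion of `SV`, isomorphic to Fock space by `fockEquiv`. -/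
abbrev Hil (V : Type*) [NormedAddCommGroup V] [InnerProductSpace ℂ V] : Type _ :=
  Completion (Sym V)

/-- The inclusion of `SV` in its completion. -/
def toHil : Sym V →ₗ[ℂ] Hil V :=
  (UniformSpace.Completion.toComplₗᵢ (𝕜 := ℂ) (E := Sym V)).toLinearMap

theorem denseRange_toHil : DenseRange (toHil (V := V)) :=
  UniformSpace.Completion.denseRange_coe

theorem norm_toHil (ψ : Sym V) : ‖toHil ψ‖ = ‖ψ‖ := UniformSpace.Completion.norm_coe ψ

theorem inner_toHil (ψ φ : Sym V) : inner ℂ (toHil ψ) (toHil φ) = inner ℂ ψ φ :=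
  UniformSpace.Completion.inner_coe ψ φ

/-- The antifunctional `⟨·|h⟩` of a vector `h` of the completion. -/
def toAnti : Hil V →ₗ[ℂ] Antidual V where
  toFun h :=
    { toFun := fun ψ => inner ℂ (toHil ψ) h
      map_add' := fun _ _ => by rw [map_add, inner_add_left]
      map_smul' := fun _ _ => by rw [map_smul, inner_smul_left, smul_eq_mul] }
  map_add' _ _ := by ext ψ; exact inner_add_right (𝕜 := ℂ) (toHil ψ) _ _
  map_smul' _ _ := by ext ψ; exact inner_smul_right (𝕜 := ℂ) (toHil ψ) _ _

theorem toAnti_apply (h : Hil V) (ψ : Sym V) : toAnti h ψ = inner ℂ (toHil ψ) h := rfl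

theorem toAnti_toHil (φ : Sym V) : toAnti (toHil φ) = embed φ := by
  ext ψ
  exact inner_toHil ψ φ

theorem boundedBy_toAnti_norm (h : Hil V) : BoundedBy (toAnti h) ‖h‖ := by
  refine ⟨norm_nonneg h, fun ψ => ?_⟩
  rw [toAnti_apply, sqrt_innerS_self, mul_comm, ← norm_toHil]
  exact norm_inner_le_norm _ _

theorem norm_le_of_boundedBy_toAnti {h : Hil V} {M : ℝ} (hM : BoundedBy (toAnti h) M) :
    ‖h‖ ≤ M := by
  have key : ‖inner ℂ h h‖ ≤ M * ‖h‖ := by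
    refine denseRange_toHil.induction_on (p := fun x => ‖inner ℂ x h‖ ≤ M * ‖x‖) h
      (isClosed_le (by fun_prop) (by fun_prop)) fun ψ => ?_
    rw [norm_toHil]
    exact hM.2 ψ
  rw [inner_self_eq_norm_sq_to_K, norm_pow, RCLike.norm_ofReal, abs_norm, sq] at key
  rcases (norm_nonneg h).eq_or_lt with h0 | h0
  · exact h0 ▸ hM.1
  · exact le_of_mul_le_mul_right key h0

theorem boundedBy_toAnti {h : Hil V} {M : ℝ} : BoundedBy (toAnti h) M ↔ ‖h‖ ≤ M := by
  refine ⟨norm_le_of_boundedBy_toAnti, fun hM => ⟨(norm_nonneg h).trans hM, fun ψ => ?_⟩⟩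
  exact ((boundedBy_toAnti_norm h).2 ψ).trans (by gcongr)

theorem toAnti_mem_fockSpace (h : Hil V) : toAnti h ∈ fockSpace V :=
  ⟨‖h‖, boundedBy_toAnti_norm h⟩

theorem toAnti_injective : Function.Injective (toAnti (V := V)) := by
  refine (injective_iff_map_eq_zero _).2 fun h hh => ?_
  have bounded : BoundedBy (toAnti h) 0 := by rw [hh]; exact ⟨le_rfl, by simp⟩
  exact norm_le_zero_iff.1 (norm_le_of_boundedBy_toAnti bounded)

theorem exists_toAnti_eq {Φ : Antidual V} (hΦ : Φ ∈ fockSpace V) : ∃ h, toAnti h = Φ := by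
  obtain ⟨M, -, hM⟩ := hΦ
  let L : Sym V →ₗ[ℂ] ℂ :=
    { toFun := fun ψ => conj (Φ ψ)
      map_add' := fun _ _ => by simp
      map_smul' := fun _ _ => by simp }
  have bounded : ∃ C, ∀ ψ, ‖L ψ‖ ≤ C * ‖toHil ψ‖ := ⟨M, fun ψ => by
    rw [norm_toHil]
    exact (RCLike.norm_conj (Φ ψ)).trans_le (hM ψ)⟩
  refine ⟨(InnerProductSpace.toDual ℂ (Hil V)).symm (L.extendOfNorm toHil), ?_⟩
  ext ψ
  rw [toAnti_apply, ← inner_conj_symm, InnerProductSpace.toDual_symm_apply,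
    LinearMap.extendOfNorm_eq denseRange_toHil bounded]
  exact Complex.conj_conj _

/-- The Riesz isomorphism of the completion of `SV` with Fock space. -/
def fockEquiv : Hil V ≃ₗ[ℂ] fockSpace V :=
  LinearEquiv.ofBijective (toAnti.codRestrict (fockSpace V) toAnti_mem_fockSpace)
    ⟨fun _ _ h => toAnti_injective (congrArg Subtype.val h), fun Φ =>
      (exists_toAnti_eq Φ.2).imp fun _ hh => Subtype.ext hh⟩

theorem coe_fockEquiv (h : Hil V) : (fockEquiv h : Antidual V) = toAnti h := rfl

theorem fockNorm_fockEquiv (h : Hil V) : fockNorm (fockEquiv h) = ‖h‖ := by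
  have hIci : {M | BoundedBy (toAnti h) M} = Set.Ici ‖h‖ := by
    ext M
    exact boundedBy_toAnti
  rw [fockNorm, coe_fockEquiv, hIci, csInf_Ici]

/-! ### Antiunitary operators -/

theorem isAntiunitary_of_surjective_of_norm_map {U : Sym V →ₗ⋆[ℂ] Antidual V}
    (W : Hil V →ₗ⋆[ℂ] Hil V) (hsurj : Function.Surjective W) (hnorm : ∀ h, ‖W h‖ = ‖h‖)
    (hU : ∀ φ, toAnti (W (toHil φ)) = U φ) : IsAntiunitary U := by
  have hinj : Function.Injective W := (injective_iff_map_eq_zero _).2 fun h hh => by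
    rw [← norm_eq_zero, ← hnorm, hh, norm_zero]
  have hbij : Function.Bijective W := ⟨hinj, hsurj⟩
  refine ⟨(fockEquiv (V := V)).toLinearMap.comp (W.comp (fockEquiv (V := V)).symm.toLinearMap),
    (fockEquiv (V := V)).bijective.comp (hbij.comp (fockEquiv (V := V)).symm.bijective),
    fun Φ => ?_, fun φ => ?_⟩
  · obtain ⟨h, rfl⟩ := (fockEquiv (V := V)).surjective Φ
    simp only [LinearMap.comp_apply, LinearEquiv.coe_coe, LinearEquiv.symm_apply_apply,
      fockNorm_fockEquiv, hnorm]
  · have hmem : embed φ ∈ fockSpace V := toAnti_toHil φ ▸ toAnti_mem_fockSpace (toHil φ)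
    have heq : (⟨embed φ, hmem⟩ : fockSpace V) = fockEquiv (toHil φ) :=
      Subtype.ext (toAnti_toHil φ).symm
    refine ⟨hmem, ?_⟩
    simp only [heq, LinearMap.comp_apply, LinearEquiv.coe_coe, LinearEquiv.symm_apply_apply,
      coe_fockEquiv, hU]

theorem IsAntiunitary.mem_fockSpace {U : Sym V →ₗ⋆[ℂ] Antidual V} (hU : IsAntiunitary U)
    (φ : Sym V) : U φ ∈ fockSpace V := by
  obtain ⟨W, -, -, hW⟩ := hU
  obtain ⟨hmem, heq⟩ := hW φ
  exact heq ▸ (W ⟨embed φ, hmem⟩).2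

theorem exists_isAntiunitary_smul {U : Sym V →ₗ⋆[ℂ] Antidual V} {W : Hil V →L⋆[ℂ] Hil V} {N : ℝ}
    (hN : 0 < N) (hsurj : Function.Surjective W) (hnorm : ∀ h, ‖W h‖ = N * ‖h‖)
    (hU : ∀ φ, toAnti (W (toHil φ)) = U φ) : ∃ c : ℂ, c ≠ 0 ∧ IsAntiunitary (c • U) := by
  have hc : ((N⁻¹ : ℝ) : ℂ) ≠ 0 := Complex.ofReal_ne_zero.2 (inv_pos.2 hN).ne'
  refine ⟨((N⁻¹ : ℝ) : ℂ), hc, isAntiunitary_of_surjective_of_norm_map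
    (((N⁻¹ : ℝ) : ℂ) • (W : Hil V →ₗ⋆[ℂ] Hil V)) (fun h => ?_) (fun h => ?_) fun φ => ?_⟩
  · obtain ⟨x, hx⟩ := hsurj (((N⁻¹ : ℝ) : ℂ)⁻¹ • h)
    exact ⟨x, by rw [LinearMap.smul_apply, ContinuousLinearMap.coe_coe, hx, smul_inv_smul₀ hc]⟩
  · rw [LinearMap.smul_apply, ContinuousLinearMap.coe_coe, norm_smul, hnorm, Complex.norm_real,
      Real.norm_of_nonneg (inv_nonneg.2 hN.le), inv_mul_cancel_left₀ hN.ne']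
  · rw [LinearMap.smul_apply, ContinuousLinearMap.coe_coe, map_smul, hU, LinearMap.smul_apply]

theorem exists_extension_of_norm_map {T : Sym V →ₗ⋆[ℂ] Hil V} {N : ℝ}
    (hT : ∀ φ, ‖T φ‖ = N * ‖φ‖) :
    ∃ W : Hil V →L⋆[ℂ] Hil V, (∀ φ, W (toHil φ) = T φ) ∧ ∀ h, ‖W h‖ = N * ‖h‖ := by
  have hext := LinearMap.extendOfNorm_eq denseRange_toHil (f := T)
    ⟨N, fun φ => by rw [norm_toHil, hT]⟩
  refine ⟨T.extendOfNorm toHil, hext, fun h => ?_⟩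
  refine denseRange_toHil.induction_on (p := fun h => ‖T.extendOfNorm toHil h‖ = N * ‖h‖) h
    (isClosed_eq (by fun_prop) (by fun_prop)) fun φ => ?_
  rw [hext, hT, norm_toHil]

/-- Mutually adjoint multiples of isometries are multiples of antiunitary operators: each is
surjective because the other is injective. -/
theorem exists_isAntiunitary_smul_of_adjoint {T T' : Sym V →ₗ⋆[ℂ] Hil V} {N N' : ℝ} (hN : 0 < N)
    (hN' : 0 < N') (hT : ∀ φ, ‖T φ‖ = N * ‖φ‖) (hT' : ∀ φ, ‖T' φ‖ = N' * ‖φ‖)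
    (hadj : ∀ φ ψ, inner ℂ (toHil ψ) (T φ) = inner ℂ (toHil φ) (T' ψ))
    {U : Sym V →ₗ⋆[ℂ] Antidual V} (hU : ∀ φ, toAnti (T φ) = U φ) :
    ∃ c : ℂ, c ≠ 0 ∧ IsAntiunitary (c • U) := by
  obtain ⟨W, hW, hWnorm⟩ := exists_extension_of_norm_map hT
  obtain ⟨W', hW', hWnorm'⟩ := exists_extension_of_norm_map hT'
  have hadj' (φ h) : inner ℂ h (W (toHil φ)) = inner ℂ (toHil φ) (W' h) := by
    refine denseRange_toHil.induction_on
      (p := fun h => inner ℂ h (W (toHil φ)) = inner ℂ (toHil φ) (W' h)) h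
      (isClosed_eq (by fun_prop) (by fun_prop)) fun ψ => ?_
    rw [hW, hW', hadj]
  have antilipschitz : AntilipschitzWith N⁻¹.toNNReal W :=
    AddMonoidHomClass.antilipschitz_of_bound W fun h => by
      rw [hWnorm, Real.coe_toNNReal _ (inv_nonneg.2 hN.le), inv_mul_cancel_left₀ hN.ne']
  refine exists_isAntiunitary_smul hN
    (surjective_of_antilipschitz_of_orthogonal_eq_zero W antilipschitz fun h hh => ?_) hWnorm
    fun φ => by rw [hW, hU]
  have hW'h : W' h = 0 := toAnti_injective <| by
    ext φ
    rw [toAnti_apply, ← hadj', ← inner_conj_symm, hh, map_zero, map_zero, LinearMap.zero_apply]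
  rwa [← norm_eq_zero, hWnorm', mul_eq_zero, or_iff_right hN'.ne', norm_eq_zero] at hW'h

end SymmetricFock

/-! ### Hilbert-Schmidt bounds -/

section HilbertSchmidt

variable {V W : Type*} [NormedAddCommGroup V] [InnerProductSpace ℂ V]
  [NormedAddCommGroup W] [InnerProductSpace ℂ W]

/-- `h` bounds the square of the Hilbert-Schmidt norm of `T`. Quantifying over finite orthonormal
families makes this independent of a Hilbert basis and applicable to antilinear `T`. -/
def HSBound {E : Type*} [Norm E] (T : V → E) (h : ℝ) : Prop :=
  ∀ (n : ℕ) (e : Fin n → V), Orthonormal ℂ e → ∑ k, ‖T (e k)‖ ^ 2 ≤ h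

theorem HSBound.sum_le {E : Type*} [Norm E] {T : V → E} {h : ℝ} (hT : HSBound T h) {ι : Type*}
    {e : ι → V} (he : Orthonormal ℂ e) (s : Finset ι) : ∑ k ∈ s, ‖T (e k)‖ ^ 2 ≤ h := by
  have hs := hT _ _ (he.comp (fun k => (s.equivFin.symm k : ι))
    (Subtype.val_injective.comp s.equivFin.symm.injective))
  rwa [← Finset.sum_coe_sort s fun k => ‖T (e k)‖ ^ 2, ← Equiv.sum_comp s.equivFin.symm]

theorem HSBound.of_norm_le {E F : Type*} [Norm E] [SeminormedAddCommGroup F] {T : V → E} {S : V → F}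
    {h K : ℝ} (hT : HSBound T h) (hS : ∀ v, ‖S v‖ ≤ K * ‖T v‖) : HSBound S (K ^ 2 * h) := by
  intro n e he
  calc ∑ k, ‖S (e k)‖ ^ 2 ≤ ∑ k, (K * ‖T (e k)‖) ^ 2 := by gcongr; exact hS _
    _ = K ^ 2 * ∑ k, ‖T (e k)‖ ^ 2 := by simp only [mul_pow, Finset.mul_sum]
    _ ≤ K ^ 2 * h := by gcongr; exact hT n e he

theorem hasSum_norm_inner_sq {κ : Type*} (b : HilbertBasis κ ℂ V) (x : V) :
    HasSum (fun j => ‖inner ℂ (b j) x‖ ^ 2) (‖x‖ ^ 2) := by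
  have h := Complex.hasSum_re (b.hasSum_inner_mul_inner x x)
  rw [inner_self_eq_norm_sq_to_K] at h
  convert h using 1
  · ext j
    rw [← inner_conj_symm x, mul_comm, Complex.mul_conj, Complex.normSq_eq_norm_sq,
      Complex.ofReal_re]
  · norm_cast

/-- Expand `‖T eₖ‖²` in the basis `b` and apply Bessel's inequality to `e`. -/
theorem hsBound_of_adjoint {T : V → W} {T' : W → V}
    (hadj : ∀ x y, ‖inner ℂ x (T y)‖ = ‖inner ℂ y (T' x)‖) {κ : Type*} (b : HilbertBasis κ ℂ W)
    {h : ℝ} (hb : ∀ s : Finset κ, ∑ j ∈ s, ‖T' (b j)‖ ^ 2 ≤ h) : HSBound T h := by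
  intro n e he
  have hs : HasSum (fun j => ∑ k, ‖inner ℂ (b j) (T (e k))‖ ^ 2) (∑ k, ‖T (e k)‖ ^ 2) :=
    hasSum_sum fun k _ => hasSum_norm_inner_sq b (T (e k))
  refine le_of_tendsto' hs fun s => (Finset.sum_le_sum fun j _ => ?_).trans (hb s)
  simp only [hadj]
  exact he.sum_inner_products_le _

theorem HSBound.adjoint [CompleteSpace W] {T : V → W} {T' : W → V}
    (hadj : ∀ x y, ‖inner ℂ x (T y)‖ = ‖inner ℂ y (T' x)‖) {h : ℝ} (hT : HSBound T' h) :
    HSBound T h := by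
  obtain ⟨w, b, -⟩ := exists_hilbertBasis ℂ W
  exact hsBound_of_adjoint hadj b fun s => hT.sum_le b.orthonormal s

theorem IsHilbertSchmidt.exists_hsBound_adjoint {T : V →ₗ[ℂ] V} {T' : V → V}
    (hadj : ∀ x y, ‖inner ℂ x (T' y)‖ = ‖inner ℂ y (T x)‖) (hT : IsHilbertSchmidt T) :
    ∃ h, HSBound T' h := by
  obtain ⟨-, w, b, hb⟩ := hT
  exact ⟨_, hsBound_of_adjoint hadj b fun s => hb.sum_le_tsum s fun _ _ => by positivity⟩

theorem HSBound.isHilbertSchmidt [CompleteSpace V] {T : V →ₗ[ℂ] V} (hc : Continuous T) {h : ℝ}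
    (hT : HSBound T h) : IsHilbertSchmidt T := by
  obtain ⟨w, b, -⟩ := exists_hilbertBasis ℂ V
  exact ⟨hc, w, b, summable_of_sum_le (fun _ => by positivity)
    fun s => hT.sum_le b.orthonormal s⟩

theorem IsHilbertSchmidt.smul {T : V →ₗ[ℂ] V} (hT : IsHilbertSchmidt T) (c : ℂ) :
    IsHilbertSchmidt (c • T) := by
  obtain ⟨hc, w, b, hb⟩ := hT
  refine ⟨hc.const_smul c, w, b, (hb.mul_left (‖c‖ ^ 2)).congr fun k => ?_⟩
  rw [LinearMap.smul_apply, norm_smul, mul_pow]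

end HilbertSchmidt

section Implementability

open Filter Topology

variable {V : Type*} [NormedAddCommGroup V] [InnerProductSpace ℂ V]

attribute [local instance] symNormedAddCommGroup symInnerProductSpace

/-! ### Gaussians in Fock space -/

theorem inner_inc (x y : V) : inner ℂ (inc V x) (inc V y) = inner ℂ x y := by
  rw [← mul_one (inc V x), inner_inc_mul_left, annih_inc, Algebra.algebraMap_eq_smul_one,
    inner_smul_right, inner_self_eq_norm_sq_to_K, norm_one_sym, RCLike.ofReal_one, one_pow, mul_one]

theorem inner_inc_mul_inc (x y z w : V) :
    inner ℂ (inc V x * inc V y) (inc V z * inc V w) =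
      inner ℂ x z * inner ℂ y w + inner ℂ x w * inner ℂ y z := by
  rw [inner_inc_mul_left, annih_inc_mul, annih_inc, ← Algebra.commutes, ← Algebra.smul_def,
    inner_add_right, inner_smul_right, inner_smul_right, inner_inc, inner_inc]

theorem norm_sum_inc_mul_inc_sq_le {Z : V →ₗ⋆[ℂ] V} (hZ : IsSymmetricAnti Z) {ι : Type*}
    [Fintype ι] {e : ι → V} (he : Orthonormal ℂ e) :
    ‖∑ k, inc V (e k) * inc V (Z (e k))‖ ^ 2 ≤ 2 * ∑ k, ‖Z (e k)‖ ^ 2 := by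
  classical
  have hterm (k l : ι) :
      inner ℂ (inc V (e k) * inc V (Z (e k))) (inc V (e l) * inc V (Z (e l))) =
        ((if k = l then ‖Z (e k)‖ ^ 2 else 0 : ℝ) : ℂ) +
          ((‖inner ℂ (e k) (Z (e l))‖ ^ 2 : ℝ) : ℂ) := by
    have hdiag : inner ℂ (e k) (e l) * inner ℂ (Z (e k)) (Z (e l)) =
        ((if k = l then ‖Z (e k)‖ ^ 2 else 0 : ℝ) : ℂ) := by
      rw [orthonormal_iff_ite.1 he, ite_mul, one_mul, zero_mul]
      split_ifs with h
      · rw [← h, inner_self_eq_norm_sq_to_K, Complex.ofReal_pow]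
        rfl
      · rw [Complex.ofReal_zero]
    rw [inner_inc_mul_inc, hdiag, ← inner_conj_symm (Z (e k)), ← hZ, Complex.mul_conj,
      Complex.normSq_eq_norm_sq]
  have hnorm : ‖∑ k, inc V (e k) * inc V (Z (e k))‖ ^ 2 =
      ∑ k, ‖Z (e k)‖ ^ 2 + ∑ l, ∑ k, ‖inner ℂ (e k) (Z (e l))‖ ^ 2 := by
    rw [← inner_self_eq_norm_sq (𝕜 := ℂ), sum_inner]
    simp only [inner_sum, hterm]
    simp only [← Complex.ofReal_add, ← Complex.ofReal_sum, RCLike.re_to_complex, Complex.ofReal_re,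
      Finset.sum_add_distrib, Finset.sum_ite_eq, Finset.mem_univ, if_true]
    rw [Finset.sum_comm (f := fun k l => ‖inner ℂ (e k) (Z (e l))‖ ^ 2)]
  have hbessel : ∑ l, ∑ k, ‖inner ℂ (e k) (Z (e l))‖ ^ 2 ≤ ∑ l, ‖Z (e l)‖ ^ 2 :=
    Finset.sum_le_sum fun _ _ => he.sum_inner_products_le _
  linarith

/-- Test `u` on `ψ = ∑ₖ eₖ (Z eₖ)`: its value is `S = ∑ₖ ‖Z eₖ‖²`, while `‖ψ‖² ≤ 2 S`. -/
theorem GaussianEquation.hsBound {Z : V →ₗ⋆[ℂ] V} (hZ : IsSymmetricAnti Z) {u : Antidual V}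
    (hu : GaussianEquation Z u) (h1 : u 1 = 1) {M : ℝ} (hM : BoundedBy u M) :
    HSBound Z (2 * M ^ 2) := by
  intro n e he
  set S := ∑ k, ‖Z (e k)‖ ^ 2 with hS
  set ψ : Sym V := ∑ k, inc V (e k) * inc V (Z (e k)) with hψ
  have hS0 : 0 ≤ S := Finset.sum_nonneg fun _ _ => by positivity
  have huψ : u ψ = (S : ℂ) := by
    rw [hψ, map_sum, hS, Complex.ofReal_sum]
    refine Finset.sum_congr rfl fun k _ => ?_
    rw [hu.apply, annih_inc, Algebra.algebraMap_eq_smul_one, map_smulₛₗ, h1, inner_conj_symm,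
      inner_self_eq_norm_sq_to_K, smul_eq_mul, mul_one, Complex.ofReal_pow]
    rfl
  have hbound : S ≤ M * ‖ψ‖ := by
    have h := hM.2 ψ
    rwa [huψ, sqrt_innerS_self, Complex.norm_real, Real.norm_of_nonneg hS0] at h
  have hsq : S * S ≤ 2 * M ^ 2 * S := by
    calc S * S ≤ (M * ‖ψ‖) * (M * ‖ψ‖) := mul_self_le_mul_self hS0 hbound
      _ = M ^ 2 * ‖ψ‖ ^ 2 := by ring
      _ ≤ M ^ 2 * (2 * S) := by gcongr; exact norm_sum_inc_mul_inc_sq_le hZ he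
      _ = 2 * M ^ 2 * S := by ring
  rcases hS0.eq_or_lt with h | h
  · rw [← h]
    positivity
  · exact le_of_mul_le_mul_right hsq h

/-- A bound, by `norm_gaussPart_sq_le`, for the squared norm of the part of degree `2n` of a
Gaussian whose exponent has operator norm at most `κ` and squared Hilbert-Schmidt norm at
most `h`. -/
def gaussBound (h κ : ℝ) : ℕ → ℝ
  | 0 => 1
  | n + 1 => (h + 2 * n * κ ^ 2) / (2 * (n + 1)) * gaussBound h κ n

theorem gaussBound_nonneg {h : ℝ} (hh : 0 ≤ h) (κ : ℝ) (n : ℕ) : 0 ≤ gaussBound h κ n := by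
  induction n with
  | zero => exact zero_le_one
  | succ n ih => rw [gaussBound]; positivity

theorem summable_gaussBound {h κ : ℝ} (hh : 0 ≤ h) (h0 : 0 ≤ κ) (h1 : κ < 1) :
    Summable (gaussBound h κ) := by
  have hκ : κ ^ 2 < 1 := pow_lt_one₀ h0 h1 two_ne_zero
  refine summable_of_ratio_norm_eventually_le (r := (1 + κ ^ 2) / 2) (by linarith) ?_
  obtain ⟨N, hN⟩ := exists_nat_gt (h / (1 - κ ^ 2))
  filter_upwards [Filter.eventually_ge_atTop N] with n hn
  have hn' : h / (1 - κ ^ 2) < n := hN.trans_le (Nat.cast_le.2 hn)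
  rw [div_lt_iff₀ (by linarith)] at hn'
  rw [Real.norm_of_nonneg (gaussBound_nonneg hh κ _),
    Real.norm_of_nonneg (gaussBound_nonneg hh κ _), gaussBound]
  refine mul_le_mul_of_nonneg_right ?_ (gaussBound_nonneg hh κ n)
  rw [div_le_div_iff₀ (by positivity) (by positivity)]
  nlinarith

theorem inner_eq_zero_of_mem_homog {m n : ℕ} (hmn : m ≠ n) {ψ φ : Sym V} (hψ : ψ ∈ homog V m)
    (hφ : φ ∈ homog V n) : inner ℂ ψ φ = 0 := by
  change innerS ψ φ = 0
  rw [← homogProj_of_mem hψ, innerS_homogProj_left, homogProj_of_mem_of_ne hmn hφ,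
    innerS_zero_right]

theorem exists_forall_antilinear_apply_eq_inner [FiniteDimensional ℂ V] (l : V →ₗ⋆[ℂ] ℂ) :
    ∃ w, ∀ v, l v = inner ℂ v w := by
  let e := stdOrthonormalBasis ℂ V
  refine ⟨∑ k, l (e k) • e k, fun v => ?_⟩
  conv_lhs => rw [← e.sum_repr' v]
  simp only [map_sum, map_smulₛₗ, inner_conj_symm, inner_sum, inner_smul_right, smul_eq_mul,
    mul_comm]

section OrthonormalBasis

variable {ι : Type*} [Fintype ι] (e : OrthonormalBasis ι ℂ V)

theorem natCast_mul_norm_sq {n : ℕ} {ψ : Sym V} (hψ : ψ ∈ homog V n) :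
    (n : ℝ) * ‖ψ‖ ^ 2 = ∑ k, ‖annih (e k) ψ‖ ^ 2 := by
  have h := congrArg Complex.re (natCast_mul_innerS_self e hψ)
  rw [← Complex.ofReal_natCast, Complex.re_ofReal_mul, Complex.re_sum] at h
  simp only [← inner_self_eq_norm_sq (𝕜 := ℂ)]
  exact h

theorem sum_norm_inner_comp_sq_le {Z : V →ₗ⋆[ℂ] V} (hZ : IsSymmetricAnti Z) {κ : ℝ}
    (hκ : ∀ v, ‖Z v‖ ≤ κ * ‖v‖) (w : V) :
    ∑ k, ‖inner ℂ (Z (e k)) w‖ ^ 2 ≤ κ ^ 2 * ∑ k, ‖inner ℂ (e k) w‖ ^ 2 := by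
  calc ∑ k, ‖inner ℂ (Z (e k)) w‖ ^ 2 = ∑ k, ‖inner ℂ (e k) (Z w)‖ ^ 2 :=
        Finset.sum_congr rfl fun k _ => by rw [norm_inner_symm, hZ]
    _ = ‖Z w‖ ^ 2 := e.sum_sq_norm_inner_right _
    _ ≤ (κ * ‖w‖) ^ 2 := pow_le_pow_left₀ (norm_nonneg _) (hκ w) 2
    _ = κ ^ 2 * ∑ k, ‖inner ℂ (e k) w‖ ^ 2 := by rw [mul_pow, e.sum_sq_norm_inner_right]

/-- Composition with `Z` multiplies the Hilbert-Schmidt norm by at most `κ`: expand `F` in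
coordinates, each of which is the inner product with a fixed vector. -/
theorem sum_norm_comp_sq_le {E : Type*} [NormedAddCommGroup E] [InnerProductSpace ℂ E]
    (F : V →ₗ⋆[ℂ] E) {Z : V →ₗ⋆[ℂ] V} (hZ : IsSymmetricAnti Z) {κ : ℝ}
    (hκ : ∀ v, ‖Z v‖ ≤ κ * ‖v‖) :
    ∑ k, ‖F (Z (e k))‖ ^ 2 ≤ κ ^ 2 * ∑ k, ‖F (e k)‖ ^ 2 := by
  have : FiniteDimensional ℂ V := e.toBasis.finiteDimensional_of_finite
  have : FiniteDimensional ℂ F.range := inferInstance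
  let f := stdOrthonormalBasis ℂ F.range
  have hnorm (v : V) : ‖F v‖ ^ 2 = ∑ m, ‖inner ℂ (f m : E) (F v)‖ ^ 2 :=
    (f.sum_sq_norm_inner_right (F.rangeRestrict v)).symm
  choose w hw using fun m =>
    exists_forall_antilinear_apply_eq_inner ((innerₛₗ ℂ (f m : E)).comp F)
  have hcoord (v : V) : ‖F v‖ ^ 2 = ∑ m, ‖inner ℂ v (w m)‖ ^ 2 :=
    (hnorm v).trans (Finset.sum_congr rfl fun m _ => congrArg (‖·‖ ^ 2) (hw m v))
  simp only [hcoord]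
  rw [Finset.sum_comm, Finset.sum_comm (f := fun k m => ‖inner ℂ (e k) (w m)‖ ^ 2),
    Finset.mul_sum]
  exact Finset.sum_le_sum fun m _ => sum_norm_inner_comp_sq_le e hZ hκ (w m)

variable (Z : V →ₗ⋆[ℂ] V)

/-- The quadratic `½ ∑ₖ eₖ (Z eₖ)`, which represents the antifunctional `ζ` with
`ζ(xy) = ⟨y | Z x⟩`. -/
def quad : Sym V := (2⁻¹ : ℂ) • ∑ k, inc V (e k) * inc V (Z (e k))

/-- The part of degree `2n` of the Gaussian of `Z`, in finite dimensions. -/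
def gaussPart (n : ℕ) : Sym V := ((n.factorial : ℂ))⁻¹ • quad e Z ^ n

theorem gaussPart_zero : gaussPart e Z 0 = 1 := by
  rw [gaussPart, Nat.factorial_zero, Nat.cast_one, inv_one, one_smul, pow_zero]

theorem quad_mem_homog : quad e Z ∈ homog V 2 := by
  refine Submodule.smul_mem _ _ (Submodule.sum_mem _ fun k _ => inc_mul_mem_homog _ ?_)
  simpa only [mul_one] using inc_mul_mem_homog (Z (e k)) one_mem_homog

theorem gaussPart_mem_homog (n : ℕ) : gaussPart e Z n ∈ homog V (2 * n) := by
  refine Submodule.smul_mem _ _ ?_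
  rw [homog, pow_mul]
  exact Submodule.pow_mem_pow _ (quad_mem_homog e Z) n

theorem norm_sum_gaussPart_sq (m : ℕ) :
    ‖∑ n ∈ Finset.range m, gaussPart e Z n‖ ^ 2 = ∑ n ∈ Finset.range m, ‖gaussPart e Z n‖ ^ 2 := by
  induction m with
  | zero => simp
  | succ m ih =>
    have horth : inner ℂ (∑ n ∈ Finset.range m, gaussPart e Z n) (gaussPart e Z m) = 0 := by
      rw [sum_inner]
      refine Finset.sum_eq_zero fun n hn => ?_
      have hne : 2 * n ≠ 2 * m := by have := Finset.mem_range.1 hn; omega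
      exact inner_eq_zero_of_mem_homog hne (gaussPart_mem_homog e Z n) (gaussPart_mem_homog e Z m)
    rw [Finset.sum_range_succ, Finset.sum_range_succ, ← ih]
    simpa only [sq] using norm_add_sq_eq_norm_sq_add_norm_sq_of_inner_eq_zero _ _ horth

variable {Z}

theorem annih_quad (hZ : IsSymmetricAnti Z) (v : V) : annih v (quad e Z) = inc V (Z v) := by
  have hfirst : ∑ k, inner ℂ v (e k) • inc V (Z (e k)) = inc V (Z v) := by
    conv_rhs => rw [← e.sum_repr' v]
    simp only [map_sum, map_smulₛₗ, inner_conj_symm, RingHom.id_apply]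
  have hsecond : ∑ k, inner ℂ v (Z (e k)) • inc V (e k) = inc V (Z v) := by
    conv_rhs => rw [← e.sum_repr' (Z v)]
    simp only [map_sum, map_smul]
    exact Finset.sum_congr rfl fun k _ => by rw [hZ]
  rw [quad, Derivation.map_smul, map_sum]
  simp only [annih_inc_mul, annih_inc, ← Algebra.commutes, ← Algebra.smul_def,
    Finset.sum_add_distrib, hfirst, hsecond]
  module

theorem annih_gaussPart (hZ : IsSymmetricAnti Z) (v : V) (n : ℕ) :
    annih v (gaussPart e Z (n + 1)) = inc V (Z v) * gaussPart e Z n := by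
  have hn : (n : ℂ) + 1 ≠ 0 := Nat.cast_add_one_ne_zero n
  rw [gaussPart, Derivation.map_smul, Derivation.leibniz_pow, annih_quad e hZ, gaussPart,
    Nat.add_sub_cancel, smul_eq_mul, mul_comm (quad e Z ^ n), ← Nat.cast_smul_eq_nsmul ℂ, smul_smul,
    mul_smul_comm, Nat.factorial_succ]
  congr 1
  push_cast
  field_simp

theorem two_mul_norm_gaussPart_succ_sq_le (hZ : IsSymmetricAnti Z) {κ : ℝ}
    (hκ : ∀ v, ‖Z v‖ ≤ κ * ‖v‖) (n : ℕ) :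
    2 * ((n : ℝ) + 1) * ‖gaussPart e Z (n + 1)‖ ^ 2 ≤
      (∑ k, ‖Z (e k)‖ ^ 2 + 2 * n * κ ^ 2) * ‖gaussPart e Z n‖ ^ 2 := by
  let F : V →ₗ⋆[ℂ] Sym V :=
    { toFun := fun v => annih v (gaussPart e Z n)
      map_add' := fun v w => by rw [annih_add]; rfl
      map_smul' := fun c v => by rw [annih_smul]; rfl }
  have hcomp : ∑ k, ‖annih (Z (e k)) (gaussPart e Z n)‖ ^ 2 ≤
      κ ^ 2 * ∑ k, ‖annih (e k) (gaussPart e Z n)‖ ^ 2 := sum_norm_comp_sq_le e F hZ hκ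
  have hsucc := natCast_mul_norm_sq e (gaussPart_mem_homog e Z (n + 1))
  simp only [annih_gaussPart e hZ, norm_inc_mul_sq, Finset.sum_add_distrib,
    ← Finset.sum_mul] at hsucc
  rw [← natCast_mul_norm_sq e (gaussPart_mem_homog e Z n)] at hcomp
  push_cast at hsucc hcomp
  linarith

theorem norm_gaussPart_sq_le (hZ : IsSymmetricAnti Z) {κ h : ℝ}
    (hκ : ∀ v, ‖Z v‖ ≤ κ * ‖v‖) (hh : ∑ k, ‖Z (e k)‖ ^ 2 ≤ h) (n : ℕ) :
    ‖gaussPart e Z n‖ ^ 2 ≤ gaussBound h κ n := by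
  have hh0 : 0 ≤ h := (Finset.sum_nonneg fun _ _ => by positivity).trans hh
  induction n with
  | zero => rw [gaussPart_zero, norm_one_sym, one_pow, gaussBound]
  | succ n ih =>
    rw [gaussBound, div_mul_eq_mul_div, le_div_iff₀ (by positivity), mul_comm]
    calc 2 * ((n : ℝ) + 1) * ‖gaussPart e Z (n + 1)‖ ^ 2
        ≤ (∑ k, ‖Z (e k)‖ ^ 2 + 2 * n * κ ^ 2) * ‖gaussPart e Z n‖ ^ 2 :=
          two_mul_norm_gaussPart_succ_sq_le e hZ hκ n
      _ ≤ (h + 2 * n * κ ^ 2) * gaussBound h κ n := by gcongr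

theorem GaussianEquation.hasSum_inner_gaussPart (hZ : IsSymmetricAnti Z) {u : Antidual V}
    (hu : GaussianEquation Z u) (h1 : u 1 = 1) (ψ : Sym V) :
    HasSum (fun n => inner ℂ ψ (gaussPart e Z n)) (u ψ) := by
  induction ψ using annih_induction Z with
  | one =>
    have hne (n : ℕ) (hn : n ≠ 0) : inner ℂ (1 : Sym V) (gaussPart e Z n) = 0 :=
      inner_eq_zero_of_mem_homog (by omega) one_mem_homog (gaussPart_mem_homog e Z n)
    convert hasSum_single 0 hne using 1
    rw [h1, gaussPart_zero, inner_self_eq_norm_sq_to_K, norm_one_sym, RCLike.ofReal_one, one_pow]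
  | smul c θ h =>
    simpa only [inner_smul_left, map_smulₛₗ, smul_eq_mul] using h.mul_left (conj c)
  | add θ η h k =>
    simpa only [inner_add_left, map_add] using h.add k
  | inc_mul v ψ ih =>
    have hzero : inner ℂ (inc V v * ψ) (gaussPart e Z 0) = 0 := by
      rw [inner_inc_mul_left, gaussPart_zero, Derivation.map_one_eq_zero, inner_zero_right]
    rw [hu.apply, ← hasSum_nat_add_iff' 1, Finset.sum_range_one, hzero, sub_zero]
    refine ih.congr_fun fun m => ?_
    rw [inner_inc_mul_left, annih_gaussPart e hZ, inner_inc_mul_right]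

theorem GaussianEquation.norm_apply_le (hZ : IsSymmetricAnti Z) {κ h : ℝ} (h0 : 0 ≤ κ)
    (hκ1 : κ < 1) (hκ : ∀ v, ‖Z v‖ ≤ κ * ‖v‖) (hh : ∑ k, ‖Z (e k)‖ ^ 2 ≤ h)
    {u : Antidual V} (hu : GaussianEquation Z u) (h1 : u 1 = 1) (ψ : Sym V) :
    ‖u ψ‖ ≤ √(∑' n, gaussBound h κ n) * ‖ψ‖ := by
  have hh0 : 0 ≤ h := (Finset.sum_nonneg fun _ _ => by positivity).trans hh
  have hlim := (hu.hasSum_inner_gaussPart e hZ h1 ψ).tendsto_sum_nat.norm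
  refine le_of_tendsto' hlim fun m => ?_
  rw [← inner_sum, mul_comm]
  refine (norm_inner_le_norm _ _).trans (mul_le_mul_of_nonneg_left ?_ (norm_nonneg _))
  refine Real.le_sqrt_of_sq_le ?_
  rw [norm_sum_gaussPart_sq]
  exact (Finset.sum_le_sum fun n _ => norm_gaussPart_sq_le e hZ hκ hh n).trans
    ((summable_gaussBound hh0 h0 hκ1).sum_le_tsum _ fun n _ => gaussBound_nonneg hh0 κ n)

end OrthonormalBasis

theorem norm_symMap_subtype (F : Submodule ℂ V) [F.HasOrthogonalProjection] (η : Sym F) :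
    ‖symMap F.subtype η‖ = ‖η‖ := by
  rw [← sqrt_innerS_self, innerS_symMap_subtype, sqrt_innerS_self]

/-- Every element of `SV` lies in `SF` for a finite-dimensional `F ⊆ V`, and there `u` is the
Gaussian of the compression of `Z` to `F`, whose norms are bounded by those of `Z`. -/
theorem GaussianEquation.mem_fockSpace {Z : V →ₗ⋆[ℂ] V} (hZ : IsSymmetricAnti Z) {κ h : ℝ}
    (h0 : 0 ≤ κ) (hκ1 : κ < 1) (hκ : ∀ v, ‖Z v‖ ≤ κ * ‖v‖) (hh : HSBound Z h) {u : Antidual V}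
    (hu : GaussianEquation Z u) (h1 : u 1 = 1) : u ∈ fockSpace V := by
  refine ⟨√(∑' n, gaussBound h κ n), Real.sqrt_nonneg _, fun ψ => ?_⟩
  obtain ⟨F, hF, η, rfl⟩ := exists_fg_mem_range_symMap_subtype ψ
  have : FiniteDimensional ℂ F := Module.Finite.iff_fg.2 hF
  let P : V →ₗ[ℂ] F := F.orthogonalProjectionOnto.toLinearMap
  have hP (v : V) (w : F) : inner ℂ v (F.subtype w) = inner ℂ (P v) w := by simp [P]
  have hPn (v : V) : ‖P v‖ ≤ ‖v‖ := F.norm_orthogonalProjectionOnto_apply_le v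
  let ZF : F →ₗ⋆[ℂ] F := P.comp (Z.comp F.subtype)
  let uF : Antidual F := u.comp (symMap F.subtype).toLinearMap
  have hZF : IsSymmetricAnti ZF := fun x y => by
    have hinner (x y : F) : inner ℂ y (ZF x) = inner ℂ (y : V) (Z x) := by
      rw [← inner_conj_symm, ← inner_conj_symm (y : V)]
      exact congrArg conj (hP _ y).symm
    rw [hinner, hinner, hZ]
  have huF : GaussianEquation ZF uF := fun v => LinearMap.ext fun θ => by
    change u (symMap F.subtype (inc F v * θ)) = u (symMap F.subtype (annih (P (Z v)) θ))
    rw [map_mul, symMap_ι, hu.apply, annih_symMap F.subtype hP]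
    rfl
  let e := stdOrthonormalBasis ℂ F
  have he : Orthonormal ℂ fun k => (e k : V) := e.orthonormal.comp_linearIsometry F.subtypeₗᵢ
  have hhF : ∑ k, ‖ZF (e k)‖ ^ 2 ≤ h :=
    (Finset.sum_le_sum fun k _ => pow_le_pow_left₀ (norm_nonneg _) (hPn _) 2).trans
      (hh.sum_le he Finset.univ)
  change ‖uF η‖ ≤ _ * √(innerS (symMap F.subtype η) (symMap F.subtype η)).re
  rw [sqrt_innerS_self, norm_symMap_subtype]
  refine huF.norm_apply_le e hZF h0 hκ1 (fun v => (hPn _).trans (hκ v)) hhF ?_ η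
  exact (congrArg u (map_one (symMap F.subtype))).trans h1

/-! ### Regular antifunctionals -/

theorem norm_sub_toHil_le {L L' : Sym V → Sym V} (hadj : ∀ ψ φ, inner ℂ (L' ψ) φ = inner ℂ ψ (L φ))
    {K : ℝ} (hK0 : 0 ≤ K) (hK : ∀ ψ, ‖L' ψ‖ ≤ K * ‖ψ‖) {y k : Hil V}
    (hy : ∀ ψ, toAnti y ψ = toAnti k (L' ψ)) (φ : Sym V) :
    ‖y - toHil (L φ)‖ ≤ K * ‖k - toHil φ‖ := by
  refine norm_le_of_boundedBy_toAnti ⟨by positivity, fun ψ => ?_⟩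
  have hdiff : toAnti (y - toHil (L φ)) ψ = toAnti (k - toHil φ) (L' ψ) := by
    rw [map_sub, map_sub, LinearMap.sub_apply, LinearMap.sub_apply, hy]
    exact congrArg _ <| ((inner_toHil ψ (L φ)).trans (hadj ψ φ).symm).trans
      (inner_toHil (L' ψ) φ).symm
  calc ‖toAnti (y - toHil (L φ)) ψ‖ ≤ ‖k - toHil φ‖ * ‖L' ψ‖ :=
        hdiff ▸ (boundedBy_toAnti_norm _).2 _
    _ ≤ ‖k - toHil φ‖ * (K * ‖ψ‖) := by gcongr; exact hK ψ
    _ = K * ‖k - toHil φ‖ * ‖ψ‖ := by ring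

theorem tendsto_toHil_of_adjoint {L L' : Sym V → Sym V}
    (hadj : ∀ ψ φ, inner ℂ (L' ψ) φ = inner ℂ ψ (L φ)) (hL' : ∃ K, 0 ≤ K ∧ ∀ ψ, ‖L' ψ‖ ≤ K * ‖ψ‖)
    {y k : Hil V} (hy : ∀ ψ, toAnti y ψ = toAnti k (L' ψ)) {φ : ℕ → Sym V}
    (hφ : Tendsto (fun n => toHil (φ n)) atTop (𝓝 k)) :
    Tendsto (fun n => toHil (L (φ n))) atTop (𝓝 y) := by
  obtain ⟨K, hK0, hK⟩ := hL'
  rw [tendsto_iff_norm_sub_tendsto_zero] at hφ ⊢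
  refine squeeze_zero (fun _ => norm_nonneg _) (fun n => ?_) (by simpa using hφ.const_mul K)
  rw [norm_sub_rev, norm_sub_rev _ k]
  exact norm_sub_toHil_le hadj hK0 hK hy _

/-- `Φ` stays in Fock space under some dilation with factor `t > 1`. Creators and annihilators
preserve this property, which makes it a substitute for a common domain of these operators. -/
def IsRegular (Φ : Antidual V) : Prop :=
  ∃ t : ℝ, 1 < t ∧ Φ.comp (dil t).toLinearMap ∈ fockSpace V

theorem mem_fockSpace_iff {Φ : Antidual V} :
    Φ ∈ fockSpace V ↔ ∃ M, 0 ≤ M ∧ ∀ ψ, ‖Φ ψ‖ ≤ M * ‖ψ‖ := Iff.rfl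

theorem mem_fockSpace_of_norm_le {Φ Ψ : Antidual V} (hΦ : Φ ∈ fockSpace V) {L : Sym V → Sym V}
    (hL : ∃ K, 0 ≤ K ∧ ∀ ψ, ‖L ψ‖ ≤ K * ‖ψ‖) {c : ℝ} (hc : 0 ≤ c)
    (h : ∀ ψ, ‖Ψ ψ‖ ≤ c * ‖Φ (L ψ)‖) : Ψ ∈ fockSpace V := by
  obtain ⟨M, hM0, hM⟩ := mem_fockSpace_iff.1 hΦ
  obtain ⟨K, hK0, hK⟩ := hL
  refine mem_fockSpace_iff.2 ⟨c * (M * K), by positivity, fun ψ => ?_⟩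
  calc ‖Ψ ψ‖ ≤ c * ‖Φ (L ψ)‖ := h ψ
    _ ≤ c * (M * (K * ‖ψ‖)) := by
        gcongr
        exact (hM _).trans (by gcongr; exact hK ψ)
    _ = c * (M * K) * ‖ψ‖ := by ring

theorem dil_dil_div {t : ℝ} (ht : t ≠ 0) (s : ℝ) (ψ : Sym V) : dil t (dil (s / t) ψ) = dil s ψ := by
  rw [dil_dil, mul_div_cancel₀ _ ht]

theorem comp_dil_mem_fockSpace_of_lt {Φ : Antidual V} {s t : ℝ} (hs : 0 ≤ s) (hst : s < t)
    (h : Φ.comp (dil t).toLinearMap ∈ fockSpace V) : Φ.comp (dil s).toLinearMap ∈ fockSpace V := by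
  have ht : 0 < t := hs.trans_lt hst
  refine mem_fockSpace_of_norm_le h (L := dil (s / t))
    (exists_bound_dil (by positivity) ((div_lt_one ht).2 hst)) zero_le_one fun ψ => ?_
  rw [one_mul]
  change ‖Φ (dil s ψ)‖ ≤ ‖Φ (dil t (dil (s / t) ψ))‖
  rw [dil_dil_div ht.ne']

namespace IsRegular

variable {Φ Ψ : Antidual V}

theorem add (hΦ : IsRegular Φ) (hΨ : IsRegular Ψ) : IsRegular (Φ + Ψ) := by
  obtain ⟨s, hs, hΦs⟩ := hΦ
  obtain ⟨t, ht, hΨt⟩ := hΨ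
  obtain ⟨r, hr, hr_lt⟩ := exists_between (lt_min hs ht)
  have hr0 : 0 ≤ r := zero_le_one.trans hr.le
  refine ⟨r, hr, ?_⟩
  rw [LinearMap.add_comp]
  exact Submodule.add_mem _
    (comp_dil_mem_fockSpace_of_lt hr0 (hr_lt.trans_le (min_le_left _ _)) hΦs)
    (comp_dil_mem_fockSpace_of_lt hr0 (hr_lt.trans_le (min_le_right _ _)) hΨt)

theorem smul (hΦ : IsRegular Φ) (c : ℂ) : IsRegular (c • Φ) := by
  obtain ⟨t, ht, hΦt⟩ := hΦ
  exact ⟨t, ht, Submodule.smul_mem _ c hΦt⟩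

theorem creat' (hΦ : IsRegular Φ) (v : V) : IsRegular (creat' v Φ) := by
  obtain ⟨t, ht, hΦt⟩ := hΦ
  obtain ⟨s, hs, hst⟩ := exists_between ht
  have ht0 : 0 < t := zero_lt_one.trans ht
  refine ⟨s, hs, mem_fockSpace_of_norm_le hΦt (L := fun ψ => annih v (dil (s / t) ψ))
    (exists_bound_annih_dil v (by positivity) ((div_lt_one ht0).2 hst)) ht0.le fun ψ => ?_⟩
  change ‖Φ (annih v (dil s ψ))‖ ≤ t * ‖Φ (dil t (annih v (dil (s / t) ψ)))‖
  rw [← dil_dil_div ht0.ne' s, annih_dil, map_smulₛₗ, norm_smul, RCLike.norm_conj,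
    Complex.norm_real, Real.norm_of_nonneg ht0.le]

theorem annih' (hΦ : IsRegular Φ) (v : V) : IsRegular (annih' v Φ) := by
  obtain ⟨t, ht, hΦt⟩ := hΦ
  obtain ⟨s, hs, hst⟩ := exists_between ht
  have ht0 : 0 < t := zero_lt_one.trans ht
  refine ⟨s, hs, mem_fockSpace_of_norm_le hΦt (L := fun ψ => inc V v * dil (s / t) ψ)
    (exists_bound_inc_mul_dil v (by positivity) ((div_lt_one ht0).2 hst))
    (inv_nonneg.2 ht0.le) fun ψ => ?_⟩
  change ‖Φ (inc V v * dil s ψ)‖ ≤ t⁻¹ * ‖Φ (dil t (inc V v * dil (s / t) ψ))‖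
  rw [map_mul (dil t), dil_inc, dil_dil_div ht0.ne', smul_mul_assoc, map_smulₛₗ,
    norm_smul, RCLike.norm_conj, Complex.norm_real, Real.norm_of_nonneg ht0.le,
    inv_mul_cancel_left₀ ht0.ne']

theorem exists_toAnti_dil (hΦ : IsRegular Φ) : ∃ (r : ℝ) (k : Hil V), 0 ≤ r ∧ r < 1 ∧
    ∀ ψ, Φ ψ = toAnti k (dil r ψ) := by
  obtain ⟨t, ht, hΦt⟩ := hΦ
  obtain ⟨k, hk⟩ := exists_toAnti_eq hΦt
  have ht0 : 0 < t := zero_lt_one.trans ht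
  refine ⟨t⁻¹, k, inv_nonneg.2 ht0.le, inv_lt_one_of_one_lt₀ ht, fun ψ => ?_⟩
  rw [hk]
  change Φ ψ = Φ (dil t (dil t⁻¹ ψ))
  rw [dil_dil, mul_inv_cancel₀ ht0.ne', dil_one]

theorem mem_fockSpace (hΦ : IsRegular Φ) : Φ ∈ fockSpace V := by
  obtain ⟨r, k, h0, h1, hk⟩ := hΦ.exists_toAnti_dil
  refine mem_fockSpace_of_norm_le (toAnti_mem_fockSpace k) (exists_bound_dil h0 h1) zero_le_one
    fun ψ => ?_
  rw [one_mul, hk]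

/-- `SV` is a core of the closure of `a(v)` on regular antifunctionals: if `k` represents the
dilated antifunctional and `φₙ → k`, the dilations of `φₙ` approximate the original one. -/
theorem exists_seq_tendsto (hΦ : IsRegular Φ) {v : V} {x a : Hil V} (hx : toAnti x = Φ)
    (ha : toAnti a = Fock.annih' v Φ) : ∃ φ : ℕ → Sym V,
      Tendsto (fun n => toHil (φ n)) atTop (𝓝 x) ∧
        Tendsto (fun n => toHil (annih v (φ n))) atTop (𝓝 a) := by
  obtain ⟨r, k, h0, h1, hk⟩ := hΦ.exists_toAnti_dil
  obtain ⟨w, hrange, hlim⟩ := mem_closure_iff_seq_limit.1 (denseRange_toHil k)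
  choose θ hθ using hrange
  obtain rfl : (fun n => toHil (θ n)) = w := funext hθ
  have hbound : ∃ K, 0 ≤ K ∧ ∀ ψ : Sym V, ‖dil r (inc V v * ψ)‖ ≤ K * ‖ψ‖ := by
    obtain ⟨K, hK0, hK⟩ := exists_bound_inc_mul_dil v h0 h1
    refine ⟨r * K, by positivity, fun ψ => ?_⟩
    rw [map_mul, dil_inc, smul_mul_assoc, norm_smul, Complex.norm_real, Real.norm_of_nonneg h0,
      mul_assoc]
    gcongr
    exact hK ψ
  refine ⟨fun n => dil r (θ n),
    tendsto_toHil_of_adjoint (L := dil r) (inner_dil r) (exists_bound_dil h0 h1)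
      (fun ψ => by rw [hx, hk]) hlim,
    tendsto_toHil_of_adjoint (L := fun φ => annih v (dil r φ)) (L' := fun ψ => dil r (inc V v * ψ))
      (fun ψ φ => by rw [inner_dil, inner_inc_mul_left]) hbound (fun ψ => ?_) hlim⟩
  rw [ha, ← hk]
  rfl

theorem inner_eq_of_creat'_of_annih' (hΦ : IsRegular Φ) {v : V} {x a y b : Hil V}
    (hx : toAnti x = Φ) (ha : toAnti a = Fock.annih' v Φ)
    (hb : toAnti b = Fock.creat' v (toAnti y)) : inner ℂ x b = inner ℂ a y := by
  obtain ⟨φ, hφx, hφa⟩ := hΦ.exists_seq_tendsto hx ha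
  refine tendsto_nhds_unique (hφx.inner tendsto_const_nhds) ?_
  refine (hφa.inner tendsto_const_nhds).congr fun n => ?_
  exact (LinearMap.congr_fun hb (φ n)).symm

end IsRegular

theorem GaussianEquation.comp_dil {Z : V →ₗ⋆[ℂ] V} {u : Antidual V} (hu : GaussianEquation Z u)
    (t : ℝ) : GaussianEquation (((t ^ 2 : ℝ) : ℂ) • Z) (u.comp (dil t).toLinearMap) :=
  fun v => LinearMap.ext fun ψ => by
    change u (dil t (inc V v * ψ)) = u (dil t (annih ((((t ^ 2 : ℝ) : ℂ) • Z) v) ψ))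
    rw [map_mul, dil_inc, smul_mul_assoc, map_smulₛₗ, hu.apply, annih_dil, map_smulₛₗ,
      LinearMap.smul_apply, annih_smul, Derivation.smul_apply, map_smul, map_smulₛₗ]
    simp only [Complex.conj_ofReal, smul_smul, ← Complex.ofReal_mul, sq]

/-- The operator norm of the exponent being less than one leaves room for a dilation. -/
theorem GaussianEquation.isRegular {Z : V →ₗ⋆[ℂ] V} (hZ : IsSymmetricAnti Z) {κ h : ℝ}
    (h0 : 0 ≤ κ) (hκ1 : κ < 1) (hκ : ∀ v, ‖Z v‖ ≤ κ * ‖v‖) (hh : HSBound Z h) {u : Antidual V}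
    (hu : GaussianEquation Z u) (h1 : u 1 = 1) : IsRegular u := by
  set t : ℝ := √(2 / (1 + κ)) with ht
  have ht2 : t ^ 2 = 2 / (1 + κ) := Real.sq_sqrt (by positivity)
  have ht1 : 1 < t := by
    rw [ht, Real.lt_sqrt zero_le_one, one_pow, one_lt_div (by positivity)]
    linarith
  have hκt : t ^ 2 * κ < 1 := by
    rw [ht2, div_mul_eq_mul_div, div_lt_one (by positivity)]
    linarith
  have hnorm (v : V) : ‖(((t ^ 2 : ℝ) : ℂ) • Z) v‖ = t ^ 2 * ‖Z v‖ := by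
    rw [LinearMap.smul_apply, norm_smul, Complex.norm_real, Real.norm_of_nonneg (sq_nonneg t)]
  have hsymm : IsSymmetricAnti (((t ^ 2 : ℝ) : ℂ) • Z) := fun x y => by
    rw [LinearMap.smul_apply, LinearMap.smul_apply, inner_smul_right, inner_smul_right, hZ]
  refine ⟨t, ht1, (hu.comp_dil t).mem_fockSpace hsymm (by positivity) hκt (fun v => ?_)
    (hh.of_norm_le fun v => (hnorm v).le) ?_⟩
  · rw [hnorm, mul_assoc]
    exact mul_le_mul_of_nonneg_left (hκ v) (sq_nonneg t)
  · exact (congrArg u (map_one (dil t))).trans h1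

/-! ### Implementation by antiunitary operators -/

theorem IsWeakMetaplectic.isRegular {g : V ≃ₗ[ℝ] V} {U : Sym V →ₗ⋆[ℂ] Antidual V}
    (hU : IsWeakMetaplectic g U) (h1 : IsRegular (U 1)) (φ : Sym V) : IsRegular (U φ) := by
  induction φ using ι_mul_induction with
  | one => exact h1
  | smul c θ h => rw [map_smulₛₗ]; exact h.smul _
  | add θ η h k => rw [map_add]; exact h.add k
  | ι_mul v θ ih =>
    have h := hU.2.1 v θ
    rw [creat, LinearMap.mulLeft_apply] at h
    rw [h]
    exact (ih.annih' _).add (ih.creat' _)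

theorem IsWeakMetaplectic.inner_map_inc_mul {g : V ≃ₗ[ℝ] V} {U : Sym V →ₗ⋆[ℂ] Antidual V}
    (hU : IsWeakMetaplectic g U) (h1 : IsRegular (U 1)) {T : Sym V →ₗ⋆[ℂ] Hil V}
    (hT : ∀ φ, toAnti (T φ) = U φ) (v : V) (φ ψ : Sym V) :
    inner ℂ (T (inc V v * φ)) (T ψ) = inner ℂ (T φ) (T (annih v ψ)) := by
  have hreg := hU.isRegular h1
  have exists_repr {Φ : Antidual V} (h : IsRegular Φ) : ∃ x, toAnti x = Φ :=
    exists_toAnti_eq h.mem_fockSpace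
  obtain ⟨a, ha⟩ := exists_repr ((hreg φ).annih' (linPart g v))
  obtain ⟨c, hc⟩ := exists_repr ((hreg φ).creat' (antiPart g v))
  obtain ⟨a', ha'⟩ := exists_repr ((hreg ψ).annih' (antiPart g v))
  obtain ⟨c', hc'⟩ := exists_repr ((hreg ψ).creat' (linPart g v))
  have hφ : T (inc V v * φ) = a + c := toAnti_injective <| by
    rw [hT, map_add, ha, hc]
    exact hU.2.1 v φ
  have hψ : T (annih v ψ) = a' + c' := toAnti_injective <| by
    rw [hT, map_add, ha', hc']
    exact hU.2.2 v ψ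
  have hcreat : inner ℂ c (T ψ) = inner ℂ (T φ) a' := by
    rw [← inner_conj_symm, ← inner_conj_symm (T φ),
      (hreg ψ).inner_eq_of_creat'_of_annih' (hT ψ) ha' (by rw [hT, hc])]
  have hannih : inner ℂ a (T ψ) = inner ℂ (T φ) c' :=
    ((hreg φ).inner_eq_of_creat'_of_annih' (hT φ) ha (by rw [hT, hc'])).symm
  rw [hφ, hψ, inner_add_left, inner_add_right, hcreat, hannih, add_comm]

section Intertwining

variable {E : Type*} [NormedAddCommGroup E] [InnerProductSpace ℂ E] {T : Sym V →ₗ⋆[ℂ] E}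
  (hT : ∀ v φ ψ, inner ℂ (T (inc V v * φ)) (T ψ) = inner ℂ (T φ) (T (annih v ψ)))
include hT

theorem inner_map_one_map (ψ : Sym V) :
    inner ℂ (T 1) (T ψ) = ((‖T 1‖ ^ 2 : ℝ) : ℂ) * inner ℂ ψ 1 := by
  induction ψ using ι_mul_induction with
  | one =>
    rw [inner_self_eq_norm_sq_to_K, inner_self_eq_norm_sq_to_K, norm_one_sym, RCLike.ofReal_one,
      one_pow, mul_one, Complex.ofReal_pow]
    rfl
  | smul c θ h => rw [map_smulₛₗ, inner_smul_right, h, inner_smul_left]; ring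
  | add θ η h k => rw [map_add, inner_add_right, h, k, inner_add_left, mul_add]
  | ι_mul v θ =>
    have hleft : inner ℂ (T 1) (T (inc V v * θ)) = 0 := by
      rw [← inner_conj_symm, hT, Derivation.map_one_eq_zero, map_zero, inner_zero_right, map_zero]
    have hright : inner ℂ (inc V v * θ) 1 = 0 := by
      rw [inner_inc_mul_left, Derivation.map_one_eq_zero, inner_zero_right]
    rw [hleft, hright, mul_zero]

theorem inner_map_map (φ ψ : Sym V) :
    inner ℂ (T φ) (T ψ) = ((‖T 1‖ ^ 2 : ℝ) : ℂ) * inner ℂ ψ φ := by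
  induction φ using ι_mul_induction generalizing ψ with
  | one => exact inner_map_one_map hT ψ
  | smul c θ h =>
    rw [map_smulₛₗ, inner_smul_left, h, inner_smul_right, Complex.conj_conj, mul_left_comm]
  | add θ η h k => rw [map_add, inner_add_left, h, k, inner_add_right, mul_add]
  | ι_mul v θ ih => rw [hT, ih, inner_inc_mul_right]

theorem norm_map_eq_norm_map_one_mul (φ : Sym V) : ‖T φ‖ = ‖T 1‖ * ‖φ‖ := by
  have hsq : ‖T φ‖ ^ 2 = (‖T 1‖ * ‖φ‖) ^ 2 := by
    rw [mul_pow, ← inner_self_eq_norm_sq (𝕜 := ℂ) (T φ), inner_map_map hT,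
      ← inner_self_eq_norm_sq (𝕜 := ℂ) φ]
    exact Complex.re_ofReal_mul _ _
  exact (pow_left_inj₀ (norm_nonneg _) (by positivity) two_ne_zero).1 hsq

end Intertwining

theorem IsWeakMetaplectic.exists_isometry {g : V ≃ₗ[ℝ] V} {U : Sym V →ₗ⋆[ℂ] Antidual V}
    (hU : IsWeakMetaplectic g U) (hU1 : U 1 ≠ 0) (h1 : IsRegular (U 1)) :
    ∃ (T : Sym V →ₗ⋆[ℂ] Hil V) (N : ℝ), 0 < N ∧ (∀ φ, toAnti (T φ) = U φ) ∧
      ∀ φ, ‖T φ‖ = N * ‖φ‖ := by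
  let T : Sym V →ₗ⋆[ℂ] Hil V := (fockEquiv (V := V)).symm.toLinearMap.comp
    (U.codRestrict (fockSpace V) fun φ => (hU.isRegular h1 φ).mem_fockSpace)
  have hT (φ : Sym V) : toAnti (T φ) = U φ :=
    congrArg Subtype.val ((fockEquiv (V := V)).apply_symm_apply _)
  refine ⟨T, ‖T 1‖, norm_pos_iff.2 fun hT1 => hU1 ?_, hT,
    norm_map_eq_norm_map_one_mul (hU.inner_map_inc_mul h1 hT)⟩
  rw [← hT, hT1, map_zero]

theorem isHilbertSchmidt_linPart_iff (g : V ≃ₗ[ℝ] V) :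
    IsHilbertSchmidt (linPart g) ↔ IsHilbertSchmidt (anticomm g) := by
  rw [anticomm_eq_smul_linPart]
  refine ⟨fun h => h.smul _, fun h => ?_⟩
  have hne : 2 * Complex.I ≠ 0 := mul_ne_zero two_ne_zero Complex.I_ne_zero
  simpa only [inv_smul_smul₀ hne] using h.smul (2 * Complex.I)⁻¹

section Implementation

variable [CompleteSpace V] {g : V ≃ₗ[ℝ] V} {U : Sym V →ₗ⋆[ℂ] Antidual V}

theorem IsAntisymplectic.hsBound_zPart (hg : IsAntisymplectic g) {h : ℝ}
    (hh : HSBound (linPart g) h) : HSBound (zPart g) h := by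
  have hle (v : V) : ‖zPart g v‖ ≤ 1 * ‖linPart g v‖ := by
    rw [one_mul, ← hg.antiPart_zPart]
    exact hg.norm_le_norm_antiPart _
  simpa only [one_pow, one_mul] using hh.of_norm_le hle

theorem KernelEquations.isRegular_apply_one (hg : IsAntisymplectic g) (hU : KernelEquations g U)
    (h1 : U 1 1 = 1) {h : ℝ} (hh : HSBound (linPart g.symm) h) : IsRegular (U 1) := by
  obtain ⟨κ, h0, hκ1, hκ⟩ := hg.symm.exists_lt_one_forall_norm_zPart_le
  exact hU.gaussianEquation_apply_one.isRegular hg.symm.isSymmetricAnti_zPart h0 hκ1 hκ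
    (hg.symm.hsBound_zPart hh) h1

theorem KernelEquations.exists_isometry (hg : IsAntisymplectic g) (hU : KernelEquations g U)
    (h1 : U 1 1 = 1) {h : ℝ} (hh : HSBound (linPart g.symm) h) :
    ∃ (T : Sym V →ₗ⋆[ℂ] Hil V) (N : ℝ), 0 < N ∧ (∀ φ, toAnti (T φ) = U φ) ∧
      ∀ φ, ‖T φ‖ = N * ‖φ‖ := by
  have hU1 : U 1 ≠ 0 := fun h0 => by simp [h0] at h1
  exact (hU.isWeakMetaplectic hg fun h0 => hU1 (by rw [h0, LinearMap.zero_apply])).exists_isometry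
    hU1 (hU.isRegular_apply_one hg h1 hh)

/-- The adjoint of `U` is `U.flip`, which satisfies the kernel equations of `g⁻¹`. -/
theorem KernelEquations.exists_isAntiunitary_smul (hg : IsAntisymplectic g)
    (hU : KernelEquations g U) (h1 : U 1 1 = 1) (hC : IsHilbertSchmidt (linPart g)) :
    ∃ c : ℂ, c ≠ 0 ∧ IsAntiunitary (c • U) := by
  obtain ⟨h, hsymm⟩ := hC.exists_hsBound_adjoint hg.symm.norm_inner_linPart
  have hlin : HSBound (linPart g) h := hsymm.adjoint hg.norm_inner_linPart
  obtain ⟨T, N, hN, hT, hTnorm⟩ := hU.exists_isometry hg h1 hsymm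
  obtain ⟨T', N', hN', hT', hTnorm'⟩ := hU.flip.exists_isometry hg.symm h1 hlin
  refine exists_isAntiunitary_smul_of_adjoint hN hN' hTnorm hTnorm' (fun φ ψ => ?_) hT
  rw [← toAnti_apply, ← toAnti_apply, hT, hT', LinearMap.flip_apply]

theorem KernelEquations.isHilbertSchmidt_linPart (hg : IsAntisymplectic g)
    (hU : KernelEquations g U) (h1 : U 1 1 = 1) {c : ℂ} (hc : c ≠ 0)
    (hcU : IsAntiunitary (c • U)) : IsHilbertSchmidt (linPart g) := by
  have hmem : c • U 1 ∈ fockSpace V := hcU.mem_fockSpace 1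
  obtain ⟨M, hM⟩ := (Submodule.smul_mem_iff _ hc).1 hmem
  have hZ : HSBound (zPart g.symm) (2 * M ^ 2) :=
    hU.gaussianEquation_apply_one.hsBound hg.symm.isSymmetricAnti_zPart h1 hM
  obtain ⟨K, -, hK⟩ := hg.symm.exists_one_le_forall_norm_antiPart_le
  have hsymm : HSBound (linPart g.symm) (K ^ 2 * (2 * M ^ 2)) := hZ.of_norm_le fun v => by
    rw [← hg.symm.antiPart_zPart]
    exact hK _
  exact (hsymm.adjoint hg.norm_inner_linPart).isHilbertSchmidt hg.continuous_linPart

end Implementation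

end Implementability

end Fock

end

open Fock in
theorem mainTheorem10 {V : Type*} [NormedAddCommGroup V] [InnerProductSpace ℂ V] [CompleteSpace V]
    (g : V ≃ₗ[ℝ] V) (hg : IsAntisymplectic g) :
    -- `A_g` and `A_{g⁻¹}` are invertible; `Z_g` is symmetric with operator norm less than one
    (Function.Bijective (antiPart g) ∧ Function.Bijective (antiPart g.symm)) ∧
    (IsSymmetricAnti (zPart g) ∧ ∃ k : ℝ, 0 ≤ k ∧ k < 1 ∧ ∀ v, ‖zPart g v‖ ≤ k * ‖v‖) ∧
    ∃ u : Antidual (Double V),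
      -- `u = e^Z` is the kernel of a weak metaplectic operator `U_g` implementing `g`
      IsGaussian (kernelZ g) u ∧ IsWeakMetaplectic g (kernelOp u) ∧
      -- uniqueness up to scale
      (∀ U : Sym V →ₗ⋆[ℂ] Antidual V, IsWeakMetaplectic g U →
        ∃ c : ℂ, c ≠ 0 ∧ U = c • kernelOp u) ∧
      -- `U_g` can be rescaled to an antiunitary precisely when `C_g` is Hilbert-Schmidt
      ((∃ c : ℂ, c ≠ 0 ∧ IsAntiunitary (c • kernelOp u)) ↔ IsHilbertSchmidt (linPart g)) ∧
      -- `g` is implemented by an antiunitary precisely when `[g, i]₊` is Hilbert-Schmidt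
      ((∃ U : Sym V →ₗ⋆[ℂ] Antidual V, IsWeakMetaplectic g U ∧ IsAntiunitary U) ↔
        IsHilbertSchmidt (anticomm g)) ∧
      (IsHilbertSchmidt (linPart g) ↔ IsHilbertSchmidt (anticomm g)) := by
  obtain ⟨u, h1, hu⟩ := exists_gaussianEquation hg.isSymmetricAnti_kernelZ
  have hK : KernelEquations g (kernelOp u) := hu.kernelEquations
  have hK1 : kernelOp u 1 1 = 1 := by simp [kernelOp_apply, h1]
  have hU : IsWeakMetaplectic g (kernelOp u) :=
    hK.isWeakMetaplectic hg fun h0 => by simp [h0] at hK1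
  have hiff : (∃ c : ℂ, c ≠ 0 ∧ IsAntiunitary (c • kernelOp u)) ↔ IsHilbertSchmidt (linPart g) :=
    ⟨fun ⟨_, hc, h⟩ => hK.isHilbertSchmidt_linPart hg hK1 hc h, hK.exists_isAntiunitary_smul hg hK1⟩
  refine ⟨⟨hg.bijective_antiPart, hg.symm.bijective_antiPart⟩,
    ⟨hg.isSymmetricAnti_zPart, hg.exists_lt_one_forall_norm_zPart_le⟩, u, hu.isGaussian h1, hU,
    fun U h => hg.exists_eq_smul h hU hK1, hiff, ?_, isHilbertSchmidt_linPart_iff g⟩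
  rw [← isHilbertSchmidt_linPart_iff, ← hiff]
  constructor
  · rintro ⟨U, h, ha⟩
    obtain ⟨c, hc, rfl⟩ := hg.exists_eq_smul h hU hK1
    exact ⟨c, hc, ha⟩
  · rintro ⟨c, hc, ha⟩
    exact ⟨_, hU.smul hc, ha⟩
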